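/- Let $d\in\mathbb N$. A sequence $\{f_n\}_{n=1}^\infty$ in $L^2(\mathbb R^d)$ is a Riesz basis if its linear span is dense and there are constants $A,B>0$ with $A\sum_n|c_n|^2\le\|\sum_n c_nf_n\|_2^2\le B\sum_n|c_n|^2$ for all finitely supported complex sequences $(c_n)$. Write $\hat f(\xi)=\int f(x)e^{-2\pi i x\cdot\xi}\,dx$ for the (unitary) Fourier transform on $L^2(\mathbb R^d)$, $\pi(a,b)f(t)=e^{2\pi i b\cdot t}f(t-a)$ for the time-frequency shifts, $g(x)=2^{d/4}e^{-\pi|x|^2}$ for the $L^2$-normalized Gaussian, $V_gf(x,\xi)=\langle f,\pi(x,\xi)g\rangle$ for the short-time Fourier transform, and, for $R>0$, let $$A_Rf=\iint_{B(0,R)\times B(0,R)}V_gf(x,\xi)\,\pi(x,\xi)g\,dx\,d\xi,\qquad f\in L^2(\mathbb R^d),$$ where $B(0,R)\subset\mathbb R^d$ is the open Euclidean ball. **Proposition.** Let $s>d$, let $(a_n,b_n)\in\mathbb R^d\times\mathbb R^d$, $n\ge 1$, be points, and let $\{f_n\}_{n=1}^\infty$ be a Riesz basis for $L^2(\mathbb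 R^d)$ such that $$\sup_{n}\Big(\int_{\mathbb R^d}|x-a_n|^{2s}|f_n(x)|^2\,dx+\int_{\mathbb R^d}|\xi-b_n|^{2s}|\widehat{f_n}(\xi)|^2\,d\xi\Big)<\infty .$$ For $R>0$ put $h_n^R=\pi(a_n,b_n)\,A_R\,\pi(a_n,b_n)^{-1}f_n$. Then there is $R_0>0$ such that for every $R\ge R_0$ the sequence $\{h_n^R\}_{n=1}^\infty$ is a Riesz basis for $L^2(\mathbb R^d)$ and, for every $t>0$, $$\sup_{n}\Big(\int_{\mathbb R^d}|x-a_n|^{2t}|h_n^R(x)|^2\,dx+\int_{\mathbb R^d}|\xi-b_n|^{2t}|\widehat{h_n^R}(\xi)|^2\,d\xi\Big)<\infty .$$ In particular there is one Riesz basis $\{h_n\}$ that satisfies the last estimate for every $t>0$. -/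

import Mathlib

open MeasureTheory
open scoped ENNReal FourierTransform RealInnerProductSpace

noncomputable section

/-- `L²(ℝ^d)`, complex valued, with respect to Lebesgue measure. -/
abbrev L2 (d : ℕ) : Type :=
  Lp (α := EuclideanSpace ℝ (Fin d)) ℂ 2

/-- A sequence in a Hilbert space is a Riesz basis: it is complete, and
`A ∑ |c n|² ≤ ‖∑ c n • f n‖² ≤ B ∑ |c n|²` with constants `0 < A`, `B`
for all finitely supported coefficient sequences. -/
def IsRieszBasis {H : Type*} [NormedAddCommGroup H] [InnerProductSpace ℂ H]
    (f : ℕ → H) : Prop :=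
  (Submodule.span ℂ (Set.range f)).topologicalClosure = ⊤ ∧
    ∃ A B : ℝ, 0 < A ∧ 0 < B ∧ ∀ (J : Finset ℕ) (c : ℕ → ℂ),
      A * ∑ n ∈ J, ‖c n‖ ^ 2 ≤ ‖∑ n ∈ J, c n • f n‖ ^ 2 ∧
      ‖∑ n ∈ J, c n • f n‖ ^ 2 ≤ B * ∑ n ∈ J, ‖c n‖ ^ 2

/-- `∫ |x - a|^{2s} |f x|² dx + ∫ |ξ - b|^{2s} |f̂ ξ|² dξ`, as an element of `[0, ∞]`, where
`f̂` is the (unitary) `L²` Fourier transform, `f̂ ξ = ∫ f x e^{-2π i x·ξ} dx`. -/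
def phaseSpaceMoment {d : ℕ} (s : ℝ) (a b : EuclideanSpace ℝ (Fin d)) (f : L2 d) : ℝ≥0∞ :=
  (∫⁻ x, ‖x - a‖ₑ ^ (2 * s) * ‖f x‖ₑ ^ 2) +
    ∫⁻ ξ, ‖ξ - b‖ₑ ^ (2 * s) * ‖(𝓕 f : L2 d) ξ‖ₑ ^ 2

/-- The sequence `f` has phase-space localization of magnitude `s` at the points
`(a n, b n)`. -/
def IsLocalizedAt {d : ℕ} (s : ℝ) (a b : ℕ → EuclideanSpace ℝ (Fin d)) (f : ℕ → L2 d) :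
    Prop :=
  (⨆ n, phaseSpaceMoment s (a n) (b n) (f n)) < ∞

/-- The character `t ↦ e^{2π i b·t}`. -/
def character {d : ℕ} (b t : EuclideanSpace ℝ (Fin d)) : ℂ :=
  Complex.exp (2 * Real.pi * Complex.I * (⟪b, t⟫ : ℝ))

theorem norm_character {d : ℕ} (b t : EuclideanSpace ℝ (Fin d)) : ‖character b t‖ = 1 := by
  rw [character, show (2 * Real.pi * Complex.I * (⟪b, t⟫ : ℝ) : ℂ)
    = ((2 * Real.pi * ⟪b, t⟫ : ℝ) : ℂ) * Complex.I by push_cast; ring]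
  exact Complex.norm_exp_ofReal_mul_I _

theorem continuous_character {d : ℕ} (b : EuclideanSpace ℝ (Fin d)) :
    Continuous (character b) := by
  unfold character
  fun_prop

theorem character_neg_mul {d : ℕ} (b t : EuclideanSpace ℝ (Fin d)) :
    character (-b) t * character b t = 1 := by
  rw [character, character, ← Complex.exp_add, Complex.exp_eq_one_iff]
  exact ⟨0, by simp⟩

theorem memLp_tfShift {d : ℕ} (a b c : EuclideanSpace ℝ (Fin d)) (f : L2 d) :
    MemLp (fun t => character b (t - c) * f (t - a)) 2 volume := by
  have h : MemLp (fun t => f (t - a)) 2 volume :=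
    (Lp.memLp f).comp_measurePreserving (measurePreserving_sub_right volume a)
  refine h.of_le ?_ ?_
  · exact (((continuous_character b).comp (continuous_id.sub continuous_const)).aestronglyMeasurable).mul
      h.aestronglyMeasurable
  · filter_upwards with t
    simp [norm_character]

/-- The time-frequency shift `π(a, b) f (t) = e^{2π i b·t} f (t - a)` on `L²(ℝ^d)`. -/
def tfShift {d : ℕ} (a b : EuclideanSpace ℝ (Fin d)) (f : L2 d) : L2 d :=
  (show MemLp (fun t => character b t * f (t - a)) 2 volume by
    simpa using memLp_tfShift a b 0 f).toLp _

/-- The inverse time-frequency shift, `f ↦ (t ↦ e^{-2π i b·(t + a)} f (t + a))`. -/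
def tfUnshift {d : ℕ} (a b : EuclideanSpace ℝ (Fin d)) (f : L2 d) : L2 d :=
  (show MemLp (fun t => character (-b) (t + a) * f (t + a)) 2 volume by
    simpa using memLp_tfShift (-a) (-b) (-a) f).toLp _

theorem coeFn_tfShift {d : ℕ} (a b : EuclideanSpace ℝ (Fin d)) (f : L2 d) :
    tfShift a b f =ᵐ[volume] fun t => character b t * f (t - a) :=
  MemLp.coeFn_toLp _

theorem coeFn_tfUnshift {d : ℕ} (a b : EuclideanSpace ℝ (Fin d)) (f : L2 d) :
    tfUnshift a b f =ᵐ[volume] fun t => character (-b) (t + a) * f (t + a) :=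
  MemLp.coeFn_toLp _

theorem tfShift_tfUnshift {d : ℕ} (a b : EuclideanSpace ℝ (Fin d)) (f : L2 d) :
    tfShift a b (tfUnshift a b f) = f := by
  apply Lp.ext
  have h := (measurePreserving_sub_right volume a).quasiMeasurePreserving.ae_eq
    (coeFn_tfUnshift a b f)
  filter_upwards [coeFn_tfShift a b (tfUnshift a b f), h] with t h1 h2
  simp only [Function.comp_apply, sub_add_cancel] at h2
  rw [h1, h2, ← mul_assoc, mul_comm (character b t), character_neg_mul, one_mul]

theorem tfUnshift_tfShift {d : ℕ} (a b : EuclideanSpace ℝ (Fin d)) (f : L2 d) :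
    tfUnshift a b (tfShift a b f) = f := by
  apply Lp.ext
  have h := (measurePreserving_add_right volume a).quasiMeasurePreserving.ae_eq
    (coeFn_tfShift a b f)
  filter_upwards [coeFn_tfUnshift a b (tfShift a b f), h] with t h1 h2
  simp only [Function.comp_apply, add_sub_cancel_right] at h2
  rw [h1, h2, ← mul_assoc, character_neg_mul, one_mul]

/-- The normalized Gaussian `g(x) = 2^{d/4} e^{-π |x|²}`, with `‖g‖₂ = 1`. -/
def gaussFun (d : ℕ) (x : EuclideanSpace ℝ (Fin d)) : ℂ :=
  (((2 : ℝ) ^ ((d : ℝ) / 4) * Real.exp (-Real.pi * ‖x‖ ^ 2) : ℝ) : ℂ)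

theorem integrable_normSq_gaussFun (d : ℕ) : Integrable (fun x => ‖gaussFun d x‖ ^ 2) := by
  have h := (GaussianFourier.integrable_cexp_neg_mul_sq_norm_add
    (V := EuclideanSpace ℝ (Fin d)) (b := ((2 * Real.pi : ℝ) : ℂ))
    (by rw [Complex.ofReal_re]; positivity) 0 0).norm.const_mul (((2 : ℝ) ^ ((d : ℝ) / 4)) ^ 2)
  refine h.congr (Filter.Eventually.of_forall fun x => ?_)
  simp only [gaussFun, Complex.norm_real, Complex.norm_exp, norm_mul, Real.norm_eq_abs,
    Real.abs_exp, mul_pow, sq_abs]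
  congr 1
  rw [← Real.exp_nat_mul]
  congr 1
  norm_cast
  simp
  ring

theorem memLp_gaussFun (d : ℕ) : MemLp (gaussFun d) 2 volume := by
  have hc : Continuous (gaussFun d) := by unfold gaussFun; fun_prop
  exact (memLp_two_iff_integrable_sq_norm hc.aestronglyMeasurable).2
    (integrable_normSq_gaussFun d)

/-- The normalized Gaussian as an element of `L²(ℝ^d)`. -/
def gauss (d : ℕ) : L2 d :=
  (memLp_gaussFun d).toLp _

/-- The short-time Fourier transform with Gaussian window,
`V_g f (x, ξ) = (f, π(x, ξ) g) = ∫ f t * conj (g (t - x)) * e^{-2π i t·ξ} dt`.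
(Mathlib's inner product is linear in the second argument.) -/
def stft {d : ℕ} (f : L2 d) (x ξ : EuclideanSpace ℝ (Fin d)) : ℂ :=
  inner ℂ (tfShift x ξ (gauss d)) f

/-- The localization operator
`A_R f = ∬_{B(0,R) × B(0,R)} V_g f (x, ξ) π(x, ξ) g dx dξ`, an `L²`-valued integral. -/
def locOp {d : ℕ} (R : ℝ) (f : L2 d) : L2 d :=
  ∫ z in Metric.ball (0 : EuclideanSpace ℝ (Fin d)) R ×ˢ
      Metric.ball (0 : EuclideanSpace ℝ (Fin d)) R,
    stft f z.1 z.2 • tfShift z.1 z.2 (gauss d)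

end

/-! Write `V` for the short-time Fourier transform, `ζ_n = (a_n, b_n)` and `B_n` for the ball of
radius `R` around `ζ_n`. By Moyal's identity `V` is an isometry into `L²(ℝ^{2d})`, and by covariance
`f_n - h_n = V*(1_{B_n^c} V f_n)`. Hence the norm of `∑ c_n (f_n - h_n)` is at most the `L²` norm of
`∑ |c_n| 1_{B_n^c} |V f_n|` (`enorm_sum_sub_tfShift_locOp_sq_le`).

The localization of `f_n` gives a uniform bound on `∫ (1+|z-ζ_n|)^{2s} |V f_n|²`. Cauchy-Schwarz
with the weights `(1+|z-ζ_n|)^{±s}` then reduces everything to showing that `∑_n 1_{B_n^c}(z)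
(1+|z-ζ_n|)^{-2s}` is small, uniformly in `z`, for large `R`. The points `ζ_n` are not assumed
separated. Instead, each `V f_n` has a fixed amount of mass near `ζ_n`, while `∑ |V f_n|²` is
bounded pointwise by the Bessel inequality. So the sum is dominated by a tail of `∫ (1+|y|)^{-2s}
dy` over `ℝ^{2d}`, which converges because `s > d` (`sum_tail_polyWeight_le`,
`exists_radius_tail_synthesis_le`). A small perturbation of a Riesz basis is a Riesz basis
(`IsRieszBasis.of_perturbation`).

Finally, `h_n` is an integral of shifted Gaussians over `B_n` with bounded coefficients. So `h_n`
and its Fourier transform lie pointwise below fixed Gaussians centred at `a_n` and `b_n`, which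
bounds all moments. -/

/-- The Euclidean space `ℝ^d`. -/
abbrev Euc (d : ℕ) : Type := EuclideanSpace ℝ (Fin d)

/-! ### The `L²` Fourier transform on `L¹ ∩ L²`. -/

theorem enorm_sq_eq_lintegral {d : ℕ} (f : L2 d) : ‖f‖ₑ ^ 2 = ∫⁻ x, ‖f x‖ₑ ^ 2 := by
  rw [Lp.enorm_def, eLpNorm_eq_lintegral_rpow_enorm_toReal (by simp) (by simp)]
  simp only [ENNReal.toReal_ofNat, ENNReal.rpow_ofNat, one_div]
  rw [← ENNReal.rpow_natCast, ← ENNReal.rpow_mul]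
  simp

/-- Both sides are tested against smooth compactly supported `φ`. The transform moves onto `φ` by
duality of tempered distributions on the left and by Fubini on the right. -/
theorem fourier_toLp_ae_eq {d : ℕ} {u : Euc d → ℂ} (h1 : Integrable u) (h2 : MemLp u 2) :
    (𝓕 (h2.toLp u) : L2 d) =ᵐ[volume] 𝓕 u := by
  have hcont : Continuous (𝓕 u) :=
    VectorFourier.fourierIntegral_continuous Real.continuous_fourierChar
      (L := innerₗ (Euc d)) continuous_inner h1
  refine ae_eq_of_integral_contDiff_smul_eq ((Lp.memLp _).locallyIntegrable (by norm_num))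
    hcont.locallyIntegrable fun φ hφ hc => ?_
  have hg₁ : HasCompactSupport (Complex.ofRealCLM ∘ φ) := hc.comp_left rfl
  have hg₂ : ContDiff ℝ (⊤ : ℕ∞) (Complex.ofRealCLM ∘ φ) := by fun_prop
  set ψ : SchwartzMap (Euc d) ℂ := hg₁.toSchwartzMap hg₂ with hψ
  have hψv : ∀ x, ψ x = (φ x : ℂ) := fun x => rfl
  have key : (Lp.toTemperedDistribution (𝓕 (h2.toLp u) : L2 d)) ψ
      = (Lp.toTemperedDistribution (h2.toLp u)) (𝓕 ψ) := by
    rw [← Lp.fourier_toTemperedDistribution_eq, TemperedDistribution.fourier_apply]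
  rw [Lp.toTemperedDistribution_apply, Lp.toTemperedDistribution_apply] at key
  have e1 : ∫ x, φ x • (𝓕 (h2.toLp u) : L2 d) x = ∫ x, ψ x • (𝓕 (h2.toLp u) : L2 d) x := by
    simp [hψv]
  rw [e1, key]
  have e2 : ∫ x, (𝓕 ψ) x • (h2.toLp u) x = ∫ x, (𝓕 (ψ : Euc d → ℂ)) x • u x := by
    refine integral_congr_ae ?_
    filter_upwards [h2.coeFn_toLp] with x hx
    rw [hx, SchwartzMap.fourier_coe]
  rw [e2]
  have h3 := VectorFourier.integral_fourierIntegral_smul_eq_flip (μ := (volume : Measure (Euc d)))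
    (ν := (volume : Measure (Euc d))) Real.continuous_fourierChar
    (L := innerₗ (Euc d)) continuous_inner (f := (ψ : Euc d → ℂ)) (g := u) ψ.integrable h1
  rw [flip_innerₗ] at h3
  refine h3.trans ?_
  refine integral_congr_ae (Filter.Eventually.of_forall fun x => ?_)
  simp only [hψv, Complex.real_smul, smul_eq_mul]
  rfl

theorem lintegral_enorm_fourier_sq {d : ℕ} {u : Euc d → ℂ} (h1 : Integrable u) (h2 : MemLp u 2) :
    ∫⁻ ξ, ‖𝓕 u ξ‖ₑ ^ 2 = ∫⁻ t, ‖u t‖ₑ ^ 2 := by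
  have e1 : ∫⁻ ξ, ‖𝓕 u ξ‖ₑ ^ 2 = ‖(𝓕 (h2.toLp u) : L2 d)‖ₑ ^ 2 := by
    rw [enorm_sq_eq_lintegral]
    refine lintegral_congr_ae ?_
    filter_upwards [fourier_toLp_ae_eq h1 h2] with x hx
    rw [hx]
  have e2 : ∫⁻ ξ, ‖u ξ‖ₑ ^ 2 = ‖h2.toLp u‖ₑ ^ 2 := by
    rw [enorm_sq_eq_lintegral]
    refine lintegral_congr_ae ?_
    filter_upwards [h2.coeFn_toLp] with x hx
    rw [hx]
  rw [e1, e2, ← ofReal_norm, ← ofReal_norm, Lp.norm_fourier_eq]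

/-! ### The Gaussian and the algebra of time-frequency shifts. -/

theorem continuous_gaussFun (d : ℕ) : Continuous (gaussFun d) := by
  unfold gaussFun; fun_prop

theorem norm_gaussFun (d : ℕ) (x : Euc d) :
    ‖gaussFun d x‖ = (2 : ℝ) ^ ((d : ℝ) / 4) * Real.exp (-Real.pi * ‖x‖ ^ 2) := by
  rw [gaussFun, Complex.norm_real, Real.norm_of_nonneg (by positivity)]

theorem integrable_gaussFun (d : ℕ) : Integrable (gaussFun d) := by
  have h := (GaussianFourier.integrable_cexp_neg_mul_sq_norm_add
    (V := Euc d) (b := (Real.pi : ℂ)) (by simp [Real.pi_pos]) 0 0).const_mul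
      (((2 : ℝ) ^ ((d : ℝ) / 4) : ℝ) : ℂ)
  refine h.congr (Filter.Eventually.of_forall fun x => ?_)
  simp [gaussFun]

theorem lintegral_enorm_gaussFun_sq (d : ℕ) : ∫⁻ x, ‖gaussFun d x‖ₑ ^ 2 = 1 := by
  have h : ∫ x, ‖gaussFun d x‖ ^ 2 = 1 := by
    have h1 := GaussianFourier.integral_rexp_neg_mul_sq_norm (V := Euc d)
      (b := 2 * Real.pi) (by positivity)
    simp only [norm_gaussFun, mul_pow, ← Real.exp_nat_mul]
    rw [integral_const_mul]
    have h2 : ∀ x : Euc d, ((2 : ℕ) : ℝ) * (-Real.pi * ‖x‖ ^ 2) = -(2 * Real.pi) * ‖x‖ ^ 2 := by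
      intro x; push_cast; ring
    simp only [h2]
    rw [h1, finrank_euclideanSpace_fin, ← Real.rpow_natCast, ← Real.rpow_mul (by norm_num)]
    have h3 : Real.pi / (2 * Real.pi) = 2⁻¹ := by field_simp
    rw [h3, Real.inv_rpow (by norm_num)]
    have h4 : (d : ℝ) / 4 * (2 : ℕ) = d / 2 := by push_cast; ring
    rw [h4]
    exact mul_inv_cancel₀ (by positivity)
  have h0 := ofReal_integral_eq_lintegral_ofReal (integrable_normSq_gaussFun d)
    (Filter.Eventually.of_forall fun x => by positivity)
  rw [h, ENNReal.ofReal_one] at h0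
  rw [h0]
  refine lintegral_congr fun x => ?_
  rw [ENNReal.ofReal_pow (norm_nonneg _), ofReal_norm]

/-- The Gaussian is its own Fourier transform, and the transform turns phase space by `(x, ξ) ↦ (ξ,
-x)`, up to a phase. -/
theorem fourier_tfShift_gaussFun {d : ℕ} (x ξ w : Euc d) :
    𝓕 (fun t => character ξ t * gaussFun d (t - x)) w
      = character ξ x * (character (-x) w * gaussFun d (w - ξ)) := by
  rw [Real.fourier_eq']
  rw [← integral_add_right_eq_self _ x]
  have h := fourier_gaussian_innerProductSpace' (V := Euc d) (b := (Real.pi : ℂ))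
    (by simp [Real.pi_pos]) ξ w
  rw [Real.fourier_eq'] at h
  have hpi : (Real.pi : ℂ) ≠ 0 := by exact_mod_cast Real.pi_ne_zero
  rw [div_self hpi, Complex.one_cpow, one_mul] at h
  have e : ∀ v : Euc d,
      Complex.exp (((-2 * Real.pi * ⟪v + x, w⟫ : ℝ) : ℂ) * Complex.I) •
        (character ξ (v + x) * gaussFun d (v + x - x))
      = (character ξ x * character (-x) w * ((2 : ℝ) ^ ((d : ℝ) / 4) : ℝ)) *
        (Complex.exp (((-2 * Real.pi * ⟪v, w⟫ : ℝ) : ℂ) * Complex.I) •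
        Complex.exp (-(Real.pi : ℂ) * (‖v‖ : ℂ) ^ 2 + 2 * Real.pi * Complex.I * (⟪ξ, v⟫ : ℝ))) := by
    intro v
    simp only [character, gaussFun, add_sub_cancel_right, inner_add_left, inner_add_right,
      inner_neg_left, smul_eq_mul, Complex.ofReal_mul, Complex.ofReal_exp]
    have : ∀ a b c p q r s C : ℂ, a + b = p + q + r + s →
        Complex.exp a * (Complex.exp b * (C * Complex.exp c)) =
        Complex.exp p * Complex.exp q * C * (Complex.exp r * Complex.exp (c + s)) := by
      intro a b c p q r s C h
      have : Complex.exp a * (Complex.exp b * (C * Complex.exp c))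
        = C * Complex.exp (a + b + c) := by rw [Complex.exp_add, Complex.exp_add]; ring
      rw [this, h, Complex.exp_add, Complex.exp_add, Complex.exp_add, Complex.exp_add,
        Complex.exp_add]
      ring
    push_cast
    apply this
    ring
  simp only [e]
  rw [integral_const_mul, h]
  have e2 : gaussFun d (w - ξ) = ((2 : ℝ) ^ ((d : ℝ) / 4) : ℝ) *
      Complex.exp (-(Real.pi : ℂ) ^ 2 * (‖ξ - w‖ : ℂ) ^ 2 / Real.pi) := by
    rw [gaussFun, norm_sub_rev w ξ, Complex.ofReal_mul, Complex.ofReal_exp]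
    congr 2
    push_cast
    field_simp
  rw [e2]
  ring

theorem tfShift_gauss_coeFn {d : ℕ} (x ξ : Euc d) :
    tfShift x ξ (gauss d) =ᵐ[volume] fun t => character ξ t * gaussFun d (t - x) := by
  have h := (measurePreserving_sub_right volume x).quasiMeasurePreserving.ae_eq
    ((memLp_gaussFun d).coeFn_toLp)
  filter_upwards [coeFn_tfShift x ξ (gauss d), h] with t h1 h2
  rw [h1]
  congr 1

theorem fourier_tfShift_gauss {d : ℕ} (x ξ : Euc d) :
    (𝓕 (tfShift x ξ (gauss d)) : L2 d) = character ξ x • tfShift ξ (-x) (gauss d) := by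
  have hm : MemLp (fun t => character ξ t * gaussFun d (t - x)) 2 volume :=
    (memLp_congr_ae (tfShift_gauss_coeFn x ξ)).1 (Lp.memLp _)
  have hi : Integrable (fun t => character ξ t * gaussFun d (t - x)) := by
    refine ((integrable_gaussFun d).comp_sub_right x).mono hm.1
      (Filter.Eventually.of_forall fun t => ?_)
    simp [norm_character]
  have e : tfShift x ξ (gauss d) = hm.toLp _ :=
    Lp.ext ((tfShift_gauss_coeFn x ξ).trans hm.coeFn_toLp.symm)
  rw [e]
  apply Lp.ext
  filter_upwards [fourier_toLp_ae_eq hi hm, Lp.coeFn_smul (character ξ x)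
    (tfShift ξ (-x) (gauss d)), tfShift_gauss_coeFn ξ (-x)] with t h1 h2 h3
  rw [h1, h2, fourier_tfShift_gaussFun, Pi.smul_apply, h3, smul_eq_mul]

theorem conj_character {d : ℕ} (b t : Euc d) :
    (starRingEnd ℂ) (character b t) = character (-b) t := by
  rw [character, character, ← Complex.exp_conj]
  congr 1
  simp [map_ofNat]

theorem inner_tfShift_tfShift {d : ℕ} (a b : Euc d) (u v : L2 d) :
    inner ℂ (tfShift a b u) (tfShift a b v) = inner ℂ u v := by
  rw [L2.inner_def, L2.inner_def, ← integral_sub_right_eq_self (fun t => inner ℂ (u t) (v t)) a]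
  refine integral_congr_ae ?_
  filter_upwards [coeFn_tfShift a b u, coeFn_tfShift a b v] with t h1 h2
  rw [h1, h2]
  simp only [RCLike.inner_apply, map_mul, conj_character]
  linear_combination (v (t - a) * (starRingEnd ℂ) (u (t - a))) * character_neg_mul b t

theorem tfShift_add {d : ℕ} (a b : Euc d) (u v : L2 d) :
    tfShift a b (u + v) = tfShift a b u + tfShift a b v := by
  apply Lp.ext
  have h := (measurePreserving_sub_right volume a).quasiMeasurePreserving.ae_eq
    (Lp.coeFn_add u v)
  filter_upwards [coeFn_tfShift a b u, coeFn_tfShift a b v, coeFn_tfShift a b (u + v),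
    Lp.coeFn_add (tfShift a b u) (tfShift a b v), h] with t h1 h2 h3 h4 h5
  simp only [Function.comp_apply, Pi.add_apply] at h5
  rw [h3, h4, Pi.add_apply, h1, h2, h5, mul_add]

theorem tfShift_smul {d : ℕ} (a b : Euc d) (c : ℂ) (u : L2 d) :
    tfShift a b (c • u) = c • tfShift a b u := by
  apply Lp.ext
  have h := (measurePreserving_sub_right volume a).quasiMeasurePreserving.ae_eq
    (Lp.coeFn_smul c u)
  filter_upwards [coeFn_tfShift a b u, coeFn_tfShift a b (c • u),
    Lp.coeFn_smul c (tfShift a b u), h] with t h1 h2 h3 h4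
  simp only [Function.comp_apply, Pi.smul_apply, smul_eq_mul] at h4
  rw [h2, h3, Pi.smul_apply, h1, h4, smul_eq_mul]
  ring

/-- The time-frequency shift as a linear isometry. -/
noncomputable def tfShiftₗᵢ {d : ℕ} (a b : Euc d) : L2 d →ₗᵢ[ℂ] L2 d :=
  LinearMap.isometryOfInner
    { toFun := tfShift a b, map_add' := tfShift_add a b, map_smul' := tfShift_smul a b }
    (inner_tfShift_tfShift a b)

theorem tfShiftₗᵢ_apply {d : ℕ} (a b : Euc d) (u : L2 d) : tfShiftₗᵢ a b u = tfShift a b u := rfl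

theorem norm_tfShift {d : ℕ} (a b : Euc d) (u : L2 d) : ‖tfShift a b u‖ = ‖u‖ :=
  (tfShiftₗᵢ a b).norm_map u

theorem norm_tfUnshift {d : ℕ} (a b : Euc d) (u : L2 d) : ‖tfUnshift a b u‖ = ‖u‖ := by
  rw [← norm_tfShift a b, tfShift_tfUnshift]

theorem tfShift_tfShift_gauss {d : ℕ} (a b x ξ : Euc d) :
    tfShift a b (tfShift x ξ (gauss d))
      = character (-ξ) a • tfShift (x + a) (ξ + b) (gauss d) := by
  apply Lp.ext
  have h := (measurePreserving_sub_right volume a).quasiMeasurePreserving.ae_eq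
    (tfShift_gauss_coeFn x ξ)
  filter_upwards [coeFn_tfShift a b (tfShift x ξ (gauss d)), h,
    tfShift_gauss_coeFn (x + a) (ξ + b),
    Lp.coeFn_smul (character (-ξ) a) (tfShift (x + a) (ξ + b) (gauss d))] with t h1 h2 h3 h4
  simp only [Function.comp_apply] at h2
  rw [h1, h2, h4, Pi.smul_apply, h3, smul_eq_mul, sub_sub, add_comm a x]
  simp only [character, ← mul_assoc, ← Complex.exp_add]
  congr 2
  simp only [inner_sub_right, inner_neg_left, inner_add_left]
  push_cast
  ring

theorem norm_gauss (d : ℕ) : ‖gauss d‖ = 1 := by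
  have h : ‖gauss d‖ₑ ^ 2 = 1 := by
    rw [enorm_sq_eq_lintegral, ← lintegral_enorm_gaussFun_sq d]
    refine lintegral_congr_ae ?_
    filter_upwards [(memLp_gaussFun d).coeFn_toLp] with x hx
    rw [gauss, hx]
  rw [← ofReal_norm, ← ENNReal.ofReal_pow (norm_nonneg _), ENNReal.ofReal_eq_one] at h
  nlinarith [norm_nonneg (gauss d)]

/-! ### Elementary properties of the short-time Fourier transform. -/

theorem norm_stft_le {d : ℕ} (f : L2 d) (x ξ : Euc d) : ‖stft f x ξ‖ ≤ ‖f‖ := by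
  refine (norm_inner_le_norm _ _).trans ?_
  rw [norm_tfShift, norm_gauss, one_mul]

theorem stft_tfUnshift {d : ℕ} (a b : Euc d) (f : L2 d) (x ξ : Euc d) :
    stft (tfUnshift a b f) x ξ = character ξ a * stft f (x + a) (ξ + b) := by
  rw [stft, ← inner_tfShift_tfShift a b, tfShift_tfUnshift, tfShift_tfShift_gauss,
    inner_smul_left, conj_character, neg_neg, stft]

/-- This symmetry lets every statement about frequency be deduced from the one about position. -/
theorem norm_stft_fourier {d : ℕ} (f : L2 d) (x ξ : Euc d) :
    ‖stft f x ξ‖ = ‖stft (𝓕 f) ξ (-x)‖ := by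
  rw [stft, ← Lp.inner_fourier_eq, fourier_tfShift_gauss, inner_smul_left, norm_mul,
    RCLike.norm_conj, norm_character, one_mul, stft]

theorem stft_eq_fourier {d : ℕ} (f : L2 d) (x ξ : Euc d) :
    stft f x ξ = 𝓕 (fun t => gaussFun d (t - x) * f t) ξ := by
  rw [stft, L2.inner_def, Real.fourier_eq']
  refine integral_congr_ae ?_
  filter_upwards [tfShift_gauss_coeFn x ξ] with t ht
  rw [ht]
  simp only [RCLike.inner_apply, map_mul, conj_character, smul_eq_mul]
  have h1 : (starRingEnd ℂ) (gaussFun d (t - x)) = gaussFun d (t - x) := by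
    rw [gaussFun, Complex.conj_ofReal]
  have h2 : character (-ξ) t
      = Complex.exp (((-2 * Real.pi * ⟪t, ξ⟫ : ℝ) : ℂ) * Complex.I) := by
    rw [character, inner_neg_left, real_inner_comm]
    congr 1
    push_cast
    ring
  rw [h1, h2]
  ring

/-! ### Gaussian envelopes and continuity in phase space. -/

theorem norm_gaussFun_le {d : ℕ} (x : Euc d) : ‖gaussFun d x‖ ≤ (2 : ℝ) ^ ((d : ℝ) / 4) := by
  rw [norm_gaussFun]
  refine mul_le_of_le_one_right (by positivity) (Real.exp_le_one_iff.2 ?_)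
  have := Real.pi_pos
  nlinarith [sq_nonneg ‖x‖]

/-- A Gaussian that dominates all translates of `gaussFun` by vectors of norm at most `r`. -/
noncomputable def gaussEnvelope (d : ℕ) (r : ℝ) (t : Euc d) : ℝ :=
  (2 : ℝ) ^ ((d : ℝ) / 4) * Real.exp (Real.pi * r ^ 2) * Real.exp (-(Real.pi / 2) * ‖t‖ ^ 2)

/-- Since `|t|² ≤ 2|t-x|² + 2|x|²`, halving the rate of decay pays for the translation, at the cost
of a factor `e^{πr²}`. -/
theorem norm_gaussFun_sub_le_envelope {d : ℕ} {r : ℝ} (t x : Euc d) (hx : ‖x‖ ≤ r) :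
    ‖gaussFun d (t - x)‖ ≤ gaussEnvelope d r t := by
  rw [norm_gaussFun, gaussEnvelope, mul_assoc, ← Real.exp_add]
  gcongr
  have h1 : ‖t‖ ≤ ‖t - x‖ + ‖x‖ := by simpa using norm_add_le (t - x) x
  have h2 : ‖t‖ ^ 2 ≤ 2 * ‖t - x‖ ^ 2 + 2 * ‖x‖ ^ 2 := by
    nlinarith [sq_nonneg (‖t - x‖ - ‖x‖), norm_nonneg t, norm_nonneg x, norm_nonneg (t - x)]
  have h3 : ‖x‖ ^ 2 ≤ r ^ 2 := by gcongr
  nlinarith [Real.pi_pos]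

theorem gaussEnvelope_nonneg (d : ℕ) (r : ℝ) (t : Euc d) : 0 ≤ gaussEnvelope d r t := by
  unfold gaussEnvelope; positivity

theorem exists_one_add_rpow_mul_exp_le (q : ℝ) {c : ℝ} (hc : 0 < c) :
    ∃ C : ℝ, ∀ y : ℝ, 0 ≤ y → (1 + y) ^ q * Real.exp (-c * y ^ 2) ≤ C := by
  obtain ⟨n, hn⟩ := exists_nat_ge q
  -- The constant comes from `X^n / n! ≤ e^X` at `X = (c/2)(1+y)²`, combined with `(1+y)² ≤ 2 +
  -- 2y²`.
  refine ⟨n.factorial / (c / 2) ^ n * Real.exp c, fun y hy => ?_⟩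
  have h1 : (1 + y) ^ q ≤ ((1 + y) ^ 2) ^ n := by
    rw [← pow_mul, ← Real.rpow_natCast]
    refine Real.rpow_le_rpow_of_exponent_le (by linarith) (hn.trans ?_)
    push_cast
    linarith [(Nat.cast_nonneg n : (0 : ℝ) ≤ n)]
  have h2 := Real.pow_div_factorial_le_exp (c / 2 * (1 + y) ^ 2) (by positivity) n
  have h3 : Real.exp (c / 2 * (1 + y) ^ 2) ≤ Real.exp c * Real.exp (c * y ^ 2) := by
    rw [← Real.exp_add]
    gcongr
    nlinarith [sq_nonneg (1 - y)]
  have h4 : ((1 + y) ^ 2) ^ n ≤ n.factorial / (c / 2) ^ n * (Real.exp c * Real.exp (c * y ^ 2)) := by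
    have h5 := h2.trans h3
    rw [mul_pow, div_le_iff₀ (by positivity)] at h5
    rw [div_mul_eq_mul_div, le_div_iff₀ (by positivity)]
    linarith
  calc (1 + y) ^ q * Real.exp (-c * y ^ 2)
      ≤ (n.factorial / (c / 2) ^ n * (Real.exp c * Real.exp (c * y ^ 2))) *
        Real.exp (-c * y ^ 2) := by gcongr; exact h1.trans h4
    _ = n.factorial / (c / 2) ^ n * Real.exp c *
        (Real.exp (c * y ^ 2) * Real.exp (-c * y ^ 2)) := by ring
    _ = _ := by rw [← Real.exp_add]; simp

theorem lintegral_rpow_mul_exp_lt_top (d : ℕ) {p c : ℝ} (hp : 0 ≤ p) (hc : 0 < c) :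
    ∫⁻ y : Euc d, ‖y‖ₑ ^ p * ENNReal.ofReal (Real.exp (-c * ‖y‖ ^ 2)) < ∞ := by
  -- The extra exponent `d + 1` leaves the integrable majorant `(1+|y|)^{-(d+1)}`.
  obtain ⟨C, hC⟩ := exists_one_add_rpow_mul_exp_le (p + (d + 1)) hc
  have hint : Integrable (fun y : Euc d => C * (1 + ‖y‖) ^ (-((d : ℝ) + 1))) :=
    (integrable_one_add_norm (by rw [finrank_euclideanSpace_fin]; linarith)).const_mul C
  refine lt_of_le_of_lt (lintegral_mono fun y => ?_) hint.lintegral_lt_top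
  rw [← ofReal_norm, ENNReal.ofReal_rpow_of_nonneg (norm_nonneg _) hp,
    ← ENNReal.ofReal_mul (by positivity)]
  refine ENNReal.ofReal_le_ofReal ?_
  have h0 : (0 : ℝ) < 1 + ‖y‖ := by positivity
  have h1 := hC ‖y‖ (norm_nonneg _)
  rw [Real.rpow_add h0] at h1
  rw [Real.rpow_neg h0.le, ← div_eq_mul_inv, le_div_iff₀ (by positivity)]
  refine le_trans ?_ h1
  have h2 : ‖y‖ ^ p ≤ (1 + ‖y‖) ^ p := Real.rpow_le_rpow (norm_nonneg _) (by linarith) hp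
  calc ‖y‖ ^ p * Real.exp (-c * ‖y‖ ^ 2) * (1 + ‖y‖) ^ ((d : ℝ) + 1)
      ≤ (1 + ‖y‖) ^ p * Real.exp (-c * ‖y‖ ^ 2) * (1 + ‖y‖) ^ ((d : ℝ) + 1) := by gcongr
    _ = _ := by ring

theorem lintegral_rpow_mul_gaussEnvelope_sq_lt_top (d : ℕ) (r : ℝ) {p : ℝ} (hp : 0 ≤ p) :
    ∫⁻ y : Euc d, ‖y‖ₑ ^ p * ENNReal.ofReal (gaussEnvelope d r y) ^ 2 < ∞ := by
  have h := lintegral_rpow_mul_exp_lt_top d hp Real.pi_pos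
  set K : ℝ := ((2 : ℝ) ^ ((d : ℝ) / 4) * Real.exp (Real.pi * r ^ 2)) ^ 2 with hK
  have e : ∀ y : Euc d, ‖y‖ₑ ^ p * ENNReal.ofReal (gaussEnvelope d r y) ^ 2
      = ENNReal.ofReal K * (‖y‖ₑ ^ p * ENNReal.ofReal (Real.exp (-Real.pi * ‖y‖ ^ 2))) := by
    intro y
    rw [← ENNReal.ofReal_pow (gaussEnvelope_nonneg d r y), mul_left_comm,
      ← ENNReal.ofReal_mul (by positivity), gaussEnvelope, mul_pow, ← hK, ← Real.exp_nat_mul]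
    congr 4
    push_cast
    ring
  simp only [e]
  rw [lintegral_const_mul' _ _ ENNReal.ofReal_ne_top]
  exact ENNReal.mul_lt_top ENNReal.ofReal_lt_top h

theorem enorm_gaussFun_sub_le {d : ℕ} {r : ℝ} (t x : Euc d) (hx : ‖x‖ ≤ r) :
    ‖gaussFun d (t - x)‖ₑ ≤ ENNReal.ofReal (gaussEnvelope d r t) := by
  rw [← ofReal_norm]
  exact ENNReal.ofReal_le_ofReal (norm_gaussFun_sub_le_envelope t x hx)

theorem continuous_character_uncurry (d : ℕ) :
    Continuous (fun p : Euc d × Euc d => character p.1 p.2) := by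
  unfold character
  fun_prop

/-- Dominated convergence: for `x` within distance 1 of `x₀`, one envelope dominates all the
translates. Continuity supplies the measurability of `V f` and the integrability defining `locOp`.
-/
theorem continuous_tfShift_gauss (d : ℕ) :
    Continuous (fun z : Euc d × Euc d => tfShift z.1 z.2 (gauss d)) := by
  rw [continuous_iff_continuousAt]
  intro z₀
  rw [ContinuousAt, tendsto_iff_edist_tendsto_0]
  have hsq : ∀ z : Euc d × Euc d,
      edist (tfShift z.1 z.2 (gauss d)) (tfShift z₀.1 z₀.2 (gauss d))
      = (∫⁻ t, ‖character z.2 t * gaussFun d (t - z.1)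
          - character z₀.2 t * gaussFun d (t - z₀.1)‖ₑ ^ 2) ^ (1 / 2 : ℝ) := by
    intro z
    have : ∫⁻ t, ‖character z.2 t * gaussFun d (t - z.1)
          - character z₀.2 t * gaussFun d (t - z₀.1)‖ₑ ^ 2
        = ‖tfShift z.1 z.2 (gauss d) - tfShift z₀.1 z₀.2 (gauss d)‖ₑ ^ 2 := by
      rw [enorm_sq_eq_lintegral]
      refine lintegral_congr_ae ?_
      filter_upwards [tfShift_gauss_coeFn z.1 z.2, tfShift_gauss_coeFn z₀.1 z₀.2,
        Lp.coeFn_sub (tfShift z.1 z.2 (gauss d)) (tfShift z₀.1 z₀.2 (gauss d))] with t h1 h2 h3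
      rw [h3, Pi.sub_apply, h1, h2]
    rw [this, edist_eq_enorm_sub, ← ENNReal.rpow_natCast, ← ENNReal.rpow_mul]
    simp
  simp only [hsq]
  have hz : (0 : ℝ≥0∞) = (0 : ℝ≥0∞) ^ (1 / 2 : ℝ) := by simp
  rw [hz]
  refine Filter.Tendsto.ennrpow_const _ ?_
  have hc : Continuous fun p : (Euc d × Euc d) × Euc d =>
      character p.1.2 p.2 * gaussFun d (p.2 - p.1.1) :=
    ((continuous_character_uncurry d).comp (f := fun p : (Euc d × Euc d) × Euc d => (p.1.2, p.2))
      (by fun_prop)).mul ((continuous_gaussFun d).comp (by fun_prop))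
  set r : ℝ := ‖z₀.1‖ + 1 with hr
  have hlim : ∫⁻ t : Euc d, (0 : ℝ≥0∞) = 0 := by simp
  rw [← hlim]
  refine tendsto_lintegral_filter_of_dominated_convergence
    (fun t => (2 * ENNReal.ofReal (gaussEnvelope d r t)) ^ 2) ?_ ?_ ?_ ?_
  · refine Filter.Eventually.of_forall fun z => ?_
    have : Continuous fun t => character z.2 t * gaussFun d (t - z.1)
          - character z₀.2 t * gaussFun d (t - z₀.1) :=
      (hc.comp (f := fun t => (z, t)) (by fun_prop)).sub
        (hc.comp (f := fun t => (z₀, t)) (by fun_prop))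
    exact this.enorm.measurable.pow_const 2
  · have hnear : ∀ᶠ z : Euc d × Euc d in nhds z₀, ‖z.1‖ < r :=
      (continuous_fst.norm.tendsto z₀).eventually_lt_const (by rw [hr]; linarith)
    filter_upwards [hnear] with z hz1
    refine Filter.Eventually.of_forall fun t => ?_
    refine pow_le_pow_left₀ zero_le ((enorm_sub_le).trans ?_) 2
    rw [two_mul]
    refine add_le_add ?_ ?_
    · rw [enorm_mul, ← ofReal_norm (character _ _), norm_character, ENNReal.ofReal_one, one_mul]
      exact enorm_gaussFun_sub_le _ _ hz1.le
    · rw [enorm_mul, ← ofReal_norm (character _ _), norm_character, ENNReal.ofReal_one, one_mul]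
      exact enorm_gaussFun_sub_le _ _ (by rw [hr]; linarith)
  · have h := lintegral_rpow_mul_gaussEnvelope_sq_lt_top d r (le_refl (0 : ℝ))
    simp only [ENNReal.rpow_zero, one_mul] at h
    simp only [mul_pow]
    rw [lintegral_const_mul' _ _ (by simp)]
    exact (ENNReal.mul_lt_top (by norm_num) h).ne
  · refine Filter.Eventually.of_forall fun t => ?_
    have h1 : Continuous fun z : Euc d × Euc d => ‖character z.2 t * gaussFun d (t - z.1)
          - character z₀.2 t * gaussFun d (t - z₀.1)‖ₑ ^ 2 := by
      have := ((hc.comp (f := fun z => (z, t)) (by fun_prop)).sub (continuous_const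
        (y := character z₀.2 t * gaussFun d (t - z₀.1)))).enorm
      exact (ENNReal.continuous_pow 2).comp this
    have h2 := h1.tendsto z₀
    simpa using h2

theorem continuous_stft {d : ℕ} (f : L2 d) :
    Continuous (fun z : Euc d × Euc d => stft f z.1 z.2) :=
  (continuous_tfShift_gauss d).inner continuous_const

theorem continuous_stft_right {d : ℕ} (f : L2 d) (x : Euc d) : 
    Continuous (fun ξ => stft f x ξ) := by
  have h := (continuous_stft f).comp (Continuous.prodMk_right x)
  simpa only [Function.comp_def] using h

/-! ### Moyal's identity and moments in phase space. -/

theorem lintegral_enorm_stft_sq_right {d : ℕ} (f : L2 d) (x : Euc d) :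
    ∫⁻ ξ, ‖stft f x ξ‖ₑ ^ 2 = ∫⁻ t, ‖gaussFun d (t - x)‖ₑ ^ 2 * ‖f t‖ₑ ^ 2 := by
  have hg : MemLp (fun t => gaussFun d (t - x)) 2 volume :=
    (memLp_gaussFun d).comp_measurePreserving (measurePreserving_sub_right volume x)
  have h1 : Integrable (fun t => gaussFun d (t - x) * f t) := hg.integrable_mul (Lp.memLp f)
  have h2 : MemLp (fun t => gaussFun d (t - x) * f t) 2 volume := by
    refine MemLp.of_le_mul (c := (2 : ℝ) ^ ((d : ℝ) / 4)) (Lp.memLp f) h1.aestronglyMeasurable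
      (Filter.Eventually.of_forall fun t => ?_)
    rw [norm_mul]
    gcongr
    exact norm_gaussFun_le _
  simp only [stft_eq_fourier]
  rw [lintegral_enorm_fourier_sq h1 h2]
  simp only [enorm_mul, mul_pow]

/-- For fixed `x`, Plancherel in `ξ` applies to `g(· - x) f`; Tonelli then puts the weight,
convolved with `|g|²`, on `|f|²`. The choices `W = 1` and `W = |· - a|^p` give Moyal's identity and
the moment bounds. -/
theorem lintegral_weight_mul_enorm_stft_sq {d : ℕ} (f : L2 d) {W : Euc d → ℝ≥0∞}
    (hW : Measurable W) :
    ∫⁻ z : Euc d × Euc d, W z.1 * ‖stft f z.1 z.2‖ₑ ^ 2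
      = ∫⁻ t, (∫⁻ x, W x * ‖gaussFun d (t - x)‖ₑ ^ 2) * ‖f t‖ₑ ^ 2 := by
  have hV := (continuous_stft f).measurable.enorm.pow_const 2
  have hfm : AEMeasurable (fun t => ‖f t‖ₑ ^ 2) :=
    (Lp.aestronglyMeasurable f).enorm.pow_const 2
  have hWV : Measurable fun z : Euc d × Euc d => W z.1 * ‖stft f z.1 z.2‖ₑ ^ 2 :=
    (hW.comp measurable_fst).mul hV
  rw [Measure.volume_eq_prod, lintegral_prod _ hWV.aemeasurable]
  have e1 : ∀ x, ∫⁻ ξ, W x * ‖stft f x ξ‖ₑ ^ 2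
      = ∫⁻ t, W x * ‖gaussFun d (t - x)‖ₑ ^ 2 * ‖f t‖ₑ ^ 2 := by
    intro x
    have hx : Measurable fun ξ => ‖stft f x ξ‖ₑ ^ 2 :=
      (continuous_stft_right f x).measurable.enorm.pow_const 2
    rw [lintegral_const_mul _ hx,
      lintegral_enorm_stft_sq_right, ← lintegral_const_mul'']
    · simp only [mul_assoc]
    · exact (((continuous_gaussFun d).comp (by fun_prop :
        Continuous fun t : Euc d => t - x)).measurable.enorm.pow_const 2).aemeasurable.mul hfm
  simp only [e1]
  have hgm : Measurable fun p : Euc d × Euc d => W p.1 * ‖gaussFun d (p.2 - p.1)‖ₑ ^ 2 :=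
    (hW.comp measurable_fst).mul (((continuous_gaussFun d).comp (by fun_prop :
        Continuous fun p : Euc d × Euc d => p.2 - p.1)).measurable.enorm.pow_const 2)
  rw [lintegral_lintegral_swap]
  · refine lintegral_congr fun t => ?_
    have ht : Measurable fun x => W x * ‖gaussFun d (t - x)‖ₑ ^ 2 :=
      hW.mul (((continuous_gaussFun d).comp (by fun_prop :
        Continuous fun x : Euc d => t - x)).measurable.enorm.pow_const 2)
    rw [lintegral_mul_const _ ht]
  · exact hgm.aemeasurable.mul
      (hfm.comp_quasiMeasurePreserving Measure.quasiMeasurePreserving_snd)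

/-- Moyal's identity. -/
theorem lintegral_enorm_stft_sq {d : ℕ} (f : L2 d) :
    ∫⁻ z : Euc d × Euc d, ‖stft f z.1 z.2‖ₑ ^ 2 = ‖f‖ₑ ^ 2 := by
  have h := lintegral_weight_mul_enorm_stft_sq f (W := fun _ => 1) measurable_const
  simp only [one_mul] at h
  rw [h, enorm_sq_eq_lintegral]
  refine lintegral_congr fun t => ?_
  have : ∫⁻ x, ‖gaussFun d (t - x)‖ₑ ^ 2 = 1 := by
    rw [lintegral_sub_left_eq_self (fun x => ‖gaussFun d x‖ₑ ^ 2) t,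
      lintegral_enorm_gaussFun_sq]
  rw [this, one_mul]

theorem ennreal_add_rpow_le (a b : ℝ≥0∞) {p : ℝ} (hp : 0 ≤ p) :
    (a + b) ^ p ≤ 2 ^ p * (a ^ p + b ^ p) := by
  have h : a + b ≤ 2 * max a b := by
    rw [two_mul]; exact add_le_add (le_max_left _ _) (le_max_right _ _)
  refine (ENNReal.rpow_le_rpow h hp).trans ?_
  rw [ENNReal.mul_rpow_of_nonneg _ _ hp]
  gcongr
  rcases max_cases a b with ⟨h, -⟩ | ⟨h, -⟩ <;> rw [h]
  · exact le_self_add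
  · exact le_add_self

theorem exists_lintegral_fst_moment_stft_le (d : ℕ) {p : ℝ} (hp : 0 ≤ p) :
    ∃ C : ℝ≥0∞, C ≠ ∞ ∧ ∀ (a : Euc d) (f : L2 d),
      ∫⁻ z : Euc d × Euc d, ‖z.1 - a‖ₑ ^ p * ‖stft f z.1 z.2‖ₑ ^ 2
        ≤ C * ((∫⁻ t, ‖t - a‖ₑ ^ p * ‖f t‖ₑ ^ 2) + ‖f‖ₑ ^ 2) := by
  set M : ℝ≥0∞ := ∫⁻ y : Euc d, ‖y‖ₑ ^ p * ‖gaussFun d y‖ₑ ^ 2 with hM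
  have hMtop : M ≠ ∞ := by
    refine ne_of_lt (lt_of_le_of_lt (lintegral_mono fun y => ?_)
      (lintegral_rpow_mul_gaussEnvelope_sq_lt_top d 0 hp))
    have := enorm_gaussFun_sub_le (d := d) (r := 0) y 0 (by simp)
    rw [sub_zero] at this
    gcongr
  have h2 : (2 : ℝ≥0∞) ^ p ≠ ∞ := ENNReal.rpow_ne_top_of_nonneg hp (by simp)
  refine ⟨2 ^ p * (1 + M), ENNReal.mul_ne_top h2 (by simp [hMtop]), fun a f => ?_⟩
  have hW : Measurable fun x : Euc d => ‖x - a‖ₑ ^ p :=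
    (continuous_id.sub continuous_const).measurable.enorm.pow_const p
  rw [lintegral_weight_mul_enorm_stft_sq f hW]
  have hfm : AEMeasurable (fun t => ‖f t‖ₑ ^ 2) :=
    (Lp.aestronglyMeasurable f).enorm.pow_const 2
  have hWf : AEMeasurable (fun t => ‖t - a‖ₑ ^ p * ‖f t‖ₑ ^ 2) := hW.aemeasurable.mul hfm
  -- The triangle inequality `|x-a| ≤ |t-a| + |t-x|` separates the moment of `f` from the Gaussian
  -- moment `M`, so the constant does not depend on `a`.
  have hin : ∀ t, ∫⁻ x, ‖x - a‖ₑ ^ p * ‖gaussFun d (t - x)‖ₑ ^ 2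
      ≤ 2 ^ p * (‖t - a‖ₑ ^ p + M) := by
    intro t
    have hgm : Measurable fun x : Euc d => ‖gaussFun d (t - x)‖ₑ ^ 2 :=
      ((continuous_gaussFun d).comp (by fun_prop :
        Continuous fun x : Euc d => t - x)).measurable.enorm.pow_const 2
    have hwm : Measurable fun x : Euc d => ‖t - x‖ₑ ^ p :=
      (by fun_prop : Continuous fun x : Euc d => t - x).measurable.enorm.pow_const p
    calc ∫⁻ x, ‖x - a‖ₑ ^ p * ‖gaussFun d (t - x)‖ₑ ^ 2
        ≤ ∫⁻ x, 2 ^ p * (‖t - a‖ₑ ^ p * ‖gaussFun d (t - x)‖ₑ ^ 2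
            + ‖t - x‖ₑ ^ p * ‖gaussFun d (t - x)‖ₑ ^ 2) := by
          refine lintegral_mono fun x => ?_
          rw [← add_mul, ← mul_assoc]
          gcongr
          refine le_trans ?_ (ennreal_add_rpow_le _ _ hp)
          refine ENNReal.rpow_le_rpow ?_ hp
          have : x - a = (t - a) - (t - x) := by abel
          rw [this]
          exact enorm_sub_le
      _ = _ := by
          rw [lintegral_const_mul' _ _ h2, lintegral_add_left (hgm.const_mul _),
            lintegral_const_mul _ hgm,
            lintegral_sub_left_eq_self (fun x => ‖gaussFun d x‖ₑ ^ 2) t,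
            lintegral_enorm_gaussFun_sq, mul_one,
            lintegral_sub_left_eq_self (fun x => ‖x‖ₑ ^ p * ‖gaussFun d x‖ₑ ^ 2) t]
  calc ∫⁻ t, (∫⁻ x, ‖x - a‖ₑ ^ p * ‖gaussFun d (t - x)‖ₑ ^ 2) * ‖f t‖ₑ ^ 2
      ≤ ∫⁻ t, 2 ^ p * (‖t - a‖ₑ ^ p * ‖f t‖ₑ ^ 2 + M * ‖f t‖ₑ ^ 2) := by
        refine lintegral_mono fun t => ?_
        rw [← add_mul, ← mul_assoc]
        gcongr
        exact hin t
    _ = 2 ^ p * ((∫⁻ t, ‖t - a‖ₑ ^ p * ‖f t‖ₑ ^ 2) + M * ‖f‖ₑ ^ 2) := by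
        rw [lintegral_const_mul' _ _ h2, lintegral_add_left' hWf,
          lintegral_const_mul'' _ hfm, ← enorm_sq_eq_lintegral]
    _ ≤ _ := by
        rw [mul_assoc]
        gcongr 2 ^ p * ?_
        rw [add_mul, one_mul, mul_add]
        refine add_le_add le_self_add ?_
        exact le_add_self

theorem lintegral_snd_weight_stft {d : ℕ} (f : L2 d) {W : Euc d → ℝ≥0∞} (hW : Measurable W) :
    ∫⁻ z : Euc d × Euc d, W z.2 * ‖stft f z.1 z.2‖ₑ ^ 2
      = ∫⁻ z : Euc d × Euc d, W z.1 * ‖stft (𝓕 f) z.1 z.2‖ₑ ^ 2 := by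
  have hmp : MeasurePreserving (fun z : Euc d × Euc d => (z.2, -z.1)) volume volume := by
    rw [Measure.volume_eq_prod]
    exact ((MeasurePreserving.id volume).prod (Measure.measurePreserving_neg volume)).comp
      Measure.measurePreserving_swap
  have hm : Measurable fun z : Euc d × Euc d => W z.1 * ‖stft (𝓕 f) z.1 z.2‖ₑ ^ 2 :=
    (hW.comp measurable_fst).mul ((continuous_stft (𝓕 f)).measurable.enorm.pow_const 2)
  rw [← hmp.lintegral_comp hm]
  refine lintegral_congr fun z => ?_
  rw [← ofReal_norm, norm_stft_fourier, ofReal_norm]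

theorem exists_lintegral_moment_stft_le (d : ℕ) {s : ℝ} (hs : 0 ≤ s) :
    ∃ C : ℝ≥0∞, C ≠ ∞ ∧ ∀ (a b : Euc d) (f : L2 d),
      ∫⁻ z : Euc d × Euc d, ‖z - (a, b)‖ₑ ^ (2 * s) * ‖stft f z.1 z.2‖ₑ ^ 2
        ≤ C * (phaseSpaceMoment s a b f + ‖f‖ₑ ^ 2) := by
  have hp : 0 ≤ 2 * s := by positivity
  obtain ⟨C, hC, h⟩ := exists_lintegral_fst_moment_stft_le d hp
  refine ⟨2 * C, ENNReal.mul_ne_top (by simp) hC, fun a b f => ?_⟩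
  have h1 := h a f
  have h2 := h b (𝓕 f)
  have hF : ‖(𝓕 f : L2 d)‖ₑ = ‖f‖ₑ := by rw [← ofReal_norm, Lp.norm_fourier_eq, ofReal_norm]
  have hW : ∀ a : Euc d, Measurable fun x : Euc d => ‖x - a‖ₑ ^ (2 * s) := fun a =>
    (continuous_id.sub continuous_const).measurable.enorm.pow_const _
  rw [← lintegral_snd_weight_stft f (hW b), hF] at h2
  calc ∫⁻ z : Euc d × Euc d, ‖z - (a, b)‖ₑ ^ (2 * s) * ‖stft f z.1 z.2‖ₑ ^ 2
      ≤ ∫⁻ z : Euc d × Euc d, (‖z.1 - a‖ₑ ^ (2 * s) * ‖stft f z.1 z.2‖ₑ ^ 2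
          + ‖z.2 - b‖ₑ ^ (2 * s) * ‖stft f z.1 z.2‖ₑ ^ 2) := by
        refine lintegral_mono fun z => ?_
        rw [← add_mul]
        gcongr
        have : ‖z - (a, b)‖ₑ = max ‖z.1 - a‖ₑ ‖z.2 - b‖ₑ := by
          rw [← ofReal_norm, ← ofReal_norm, ← ofReal_norm, Prod.norm_def, ENNReal.ofReal_max]
          rfl
        rw [this]
        rcases max_cases ‖z.1 - a‖ₑ ‖z.2 - b‖ₑ with ⟨h, -⟩ | ⟨h, -⟩ <;> rw [h]
        · exact le_self_add
        · exact le_add_self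
    _ = (∫⁻ z : Euc d × Euc d, ‖z.1 - a‖ₑ ^ (2 * s) * ‖stft f z.1 z.2‖ₑ ^ 2)
          + ∫⁻ z : Euc d × Euc d, ‖z.2 - b‖ₑ ^ (2 * s) * ‖stft f z.1 z.2‖ₑ ^ 2 :=
        lintegral_add_left (((hW a).comp measurable_fst).mul
          ((continuous_stft f).measurable.enorm.pow_const 2)) _
    _ ≤ C * ((∫⁻ t, ‖t - a‖ₑ ^ (2 * s) * ‖f t‖ₑ ^ 2) + ‖f‖ₑ ^ 2)
          + C * ((∫⁻ t, ‖t - b‖ₑ ^ (2 * s) * ‖(𝓕 f : L2 d) t‖ₑ ^ 2) + ‖f‖ₑ ^ 2) :=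
        add_le_add h1 h2
    _ ≤ _ := by
        rw [phaseSpaceMoment, ← mul_add, mul_assoc, mul_left_comm]
        gcongr C * ?_
        generalize (∫⁻ t, ‖t - a‖ₑ ^ (2 * s) * ‖f t‖ₑ ^ 2) = X
        generalize (∫⁻ t, ‖t - b‖ₑ ^ (2 * s) * ‖(𝓕 f : L2 d) t‖ₑ ^ 2) = Y
        rw [two_mul]
        gcongr
        · exact le_self_add
        · exact le_add_self

theorem memLp_stft {d : ℕ} (f : L2 d) :
    MemLp (fun z : Euc d × Euc d => stft f z.1 z.2) 2 volume := by
  refine ⟨(continuous_stft f).aestronglyMeasurable, ?_⟩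
  rw [eLpNorm_lt_top_iff_lintegral_rpow_enorm_lt_top (by simp) (by simp)]
  simp only [ENNReal.toReal_ofNat, ENNReal.rpow_ofNat]
  rw [lintegral_enorm_stft_sq]
  simp

/-- The short-time Fourier transform as a linear isometry from `L²(ℝ^d)` to `L²(ℝ^{2d})`. -/
noncomputable def stftₗᵢ (d : ℕ) : L2 d →ₗᵢ[ℂ] Lp (α := Euc d × Euc d) ℂ 2 volume where
  toFun f := (memLp_stft f).toLp _
  map_add' f g := by
    rw [← MemLp.toLp_add]
    congr 1
    funext z
    simp [stft, inner_add_right]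
  map_smul' c f := by
    rw [RingHom.id_apply, ← MemLp.toLp_const_smul]
    congr 1
    funext z
    simp [stft, inner_smul_right]
  norm_map' f := by
    have h : ‖(memLp_stft f).toLp _‖ₑ = ‖f‖ₑ := by
      rw [Lp.enorm_def, eLpNorm_congr_ae (memLp_stft f).coeFn_toLp,
        eLpNorm_eq_lintegral_rpow_enorm_toReal (by simp) (by simp)]
      simp only [ENNReal.toReal_ofNat, ENNReal.rpow_ofNat, one_div]
      rw [lintegral_enorm_stft_sq, ← ENNReal.rpow_natCast, ← ENNReal.rpow_mul]
      simp
    simpa using congrArg ENNReal.toReal h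

/-- Moyal's identity polarized: the weak form of the inversion formula `f = ∫ V f(z) π(z) g dz`. -/
theorem integral_inner_stft {d : ℕ} (h f : L2 d) :
    ∫ z : Euc d × Euc d, inner ℂ (stft h z.1 z.2) (stft f z.1 z.2) = inner ℂ h f := by
  rw [← (stftₗᵢ d).inner_map_map h f, L2.inner_def]
  refine integral_congr_ae ?_
  filter_upwards [(memLp_stft h).coeFn_toLp, (memLp_stft f).coeFn_toLp] with z h1 h2
  exact congrArg₂ _ h1.symm h2.symm

theorem integrable_inner_stft {d : ℕ} (h f : L2 d) :
    Integrable fun z : Euc d × Euc d => inner ℂ (stft h z.1 z.2) (stft f z.1 z.2) := by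
  simp only [RCLike.inner_apply]
  exact (memLp_stft f).integrable_mul (memLp_stft h).star

/-! ### Almost orthogonality of tails of concentrated families. -/

/-- The weight `(1 + ‖y‖)^p` with values in `[0, ∞]`. -/
noncomputable def polyWeight {E : Type*} [NormedAddCommGroup E] (p : ℝ) (y : E) : ℝ≥0∞ := (1 + ‖y‖ₑ) ^ p

section PolyWeight

variable {E : Type*} [NormedAddCommGroup E]

theorem one_add_enorm_ne_top (y : E) : 1 + ‖y‖ₑ ≠ ∞ := by simp

theorem one_add_enorm_ne_zero (y : E) : 1 + ‖y‖ₑ ≠ 0 := by simp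

theorem polyWeight_add (p q : ℝ) (y : E) :
    polyWeight (p + q) y = polyWeight p y * polyWeight q y :=
  ENNReal.rpow_add _ _ (one_add_enorm_ne_zero y) (one_add_enorm_ne_top y)

theorem polyWeight_zero (y : E) : polyWeight 0 y = 1 := ENNReal.rpow_zero

theorem polyWeight_sq (p : ℝ) (y : E) : polyWeight p y ^ 2 = polyWeight (2 * p) y := by
  rw [sq, ← polyWeight_add, two_mul]

theorem measurable_polyWeight [MeasurableSpace E] [BorelSpace E] (p : ℝ) :
    Measurable (polyWeight p : E → ℝ≥0∞) := by
  unfold polyWeight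
  fun_prop

/-- A Peetre-type inequality: `1+|z-w| ≤ (1+r)(1+|z-y|)`, so moving the centre by `r` costs only a
constant. -/
theorem polyWeight_neg_le {p : ℝ} (hp : 0 ≤ p) {r : ℝ} {z y w : E}
    (h : ‖w - y‖ ≤ r) :
    polyWeight (-p) (z - y) ≤ ENNReal.ofReal (1 + r) ^ p * polyWeight (-p) (z - w) := by
  have hr : 0 ≤ r := (norm_nonneg _).trans h
  have h1 : 1 + ‖z - w‖ₑ ≤ ENNReal.ofReal (1 + r) * (1 + ‖z - y‖ₑ) := by
    have h2 : 1 + ‖z - w‖ ≤ (1 + r) * (1 + ‖z - y‖) := by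
      have h3 : ‖z - w‖ ≤ ‖z - y‖ + ‖w - y‖ := by
        have := norm_sub_le (z - y) (w - y)
        simpa using this
      nlinarith [norm_nonneg (z - y), mul_nonneg hr (norm_nonneg (z - y))]
    have h4 := ENNReal.ofReal_le_ofReal h2
    rwa [ENNReal.ofReal_mul (by positivity), ENNReal.ofReal_add (by norm_num) (norm_nonneg _),
      ENNReal.ofReal_add (by norm_num : (0 : ℝ) ≤ 1) (norm_nonneg (z - y)), ENNReal.ofReal_one,
      ofReal_norm, ofReal_norm] at h4
  have h5 := ENNReal.rpow_le_rpow h1 hp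
  rw [ENNReal.mul_rpow_of_nonneg _ _ hp] at h5
  change polyWeight p (z - w) ≤ _ * polyWeight p (z - y) at h5
  calc polyWeight (-p) (z - y)
      = polyWeight (-p) (z - y) * (polyWeight (-p) (z - w) * polyWeight p (z - w)) := by
        rw [← polyWeight_add, neg_add_cancel, polyWeight_zero, mul_one]
    _ ≤ polyWeight (-p) (z - y) * (polyWeight (-p) (z - w) *
          (ENNReal.ofReal (1 + r) ^ p * polyWeight p (z - y))) := by gcongr
    _ = (polyWeight (-p) (z - y) * polyWeight p (z - y)) *
          (ENNReal.ofReal (1 + r) ^ p * polyWeight (-p) (z - w)) := by ring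
    _ = _ := by rw [← polyWeight_add, neg_add_cancel, polyWeight_zero, one_mul]

variable [MeasurableSpace E] [BorelSpace E] (μ : Measure E)
  {ι : Type*} {F : ι → E → ℂ} {ζ : ι → E} {s : ℝ} {A B M : ℝ≥0∞}

/-- Chebyshev: the weight is at least `r^{2s}` off the ball, so `r^{2s} ≥ M/(A/2)` leaves at most
`A/2` of the mass outside. -/
theorem exists_radius_concentration (hs : 0 < s) (hFm : ∀ n, Measurable (F n))
    (hM : M ≠ ∞) (hA0 : A ≠ 0) (hAtop : A ≠ ∞)
    (hFM : ∀ n, ∫⁻ z, polyWeight (2 * s) (z - ζ n) * ‖F n z‖ₑ ^ 2 ∂μ ≤ M)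
    (hFA : ∀ n, A ≤ ∫⁻ z, ‖F n z‖ₑ ^ 2 ∂μ) :
    ∃ r : ℝ, 0 < r ∧ ∀ n, A / 2 ≤ ∫⁻ z in Metric.ball (ζ n) r, ‖F n z‖ₑ ^ 2 ∂μ := by
  have hp : 0 < 2 * s := by positivity
  have hA2 : A / 2 ≠ 0 := by simp [hA0]
  have hA2t : A / 2 ≠ ∞ := by simp [ENNReal.div_eq_top, hAtop]
  have hq : M / (A / 2) ≠ ∞ := ENNReal.div_ne_top hM hA2
  obtain ⟨r, hr0, hr⟩ : ∃ r : ℝ, 0 < r ∧ M / (A / 2) ≤ ENNReal.ofReal r ^ (2 * s) := by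
    have ht : Filter.Tendsto (fun r : ℝ => r ^ (2 * s)) Filter.atTop Filter.atTop :=
      tendsto_rpow_atTop hp
    obtain ⟨r, hr1, hr2⟩ := ((ht.eventually_ge_atTop (M / (A / 2)).toReal).and
      (Filter.eventually_gt_atTop 0)).exists
    refine ⟨r, hr2, ?_⟩
    rw [ENNReal.ofReal_rpow_of_pos hr2]
    exact (ENNReal.le_ofReal_iff_toReal_le hq (by positivity)).2 hr1
  refine ⟨r, hr0, fun n => ?_⟩
  have hc : ∫⁻ z in (Metric.ball (ζ n) r)ᶜ, ‖F n z‖ₑ ^ 2 ∂μ ≤ A / 2 := by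
    have h1 : ENNReal.ofReal r ^ (2 * s) * ∫⁻ z in (Metric.ball (ζ n) r)ᶜ, ‖F n z‖ₑ ^ 2 ∂μ ≤ M := by
      rw [← lintegral_const_mul _ ((hFm n).enorm.pow_const 2)]
      refine le_trans (setLIntegral_mono' measurableSet_ball.compl fun z hz => ?_)
        ((setLIntegral_le_lintegral _ _).trans (hFM n))
      gcongr
      refine ENNReal.rpow_le_rpow ?_ hp.le
      have : r ≤ ‖z - ζ n‖ := by
        simpa [Metric.mem_ball, dist_eq_norm] using hz
      rw [← ofReal_norm]
      exact (ENNReal.ofReal_le_ofReal this).trans le_add_self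
    have h2 := (mul_le_mul_left hr (∫⁻ z in (Metric.ball (ζ n) r)ᶜ, ‖F n z‖ₑ ^ 2 ∂μ)).trans h1
    by_cases hM0 : M = 0
    · have hpos : ENNReal.ofReal r ^ (2 * s) ≠ 0 := by
        rw [ENNReal.ofReal_rpow_of_pos hr0]
        simp only [ne_eq, ENNReal.ofReal_eq_zero, not_le]
        positivity
      rw [hM0, nonpos_iff_eq_zero, mul_eq_zero] at h1
      rw [h1.resolve_left hpos]
      exact zero_le
    · have h3 : M * (∫⁻ z in (Metric.ball (ζ n) r)ᶜ, ‖F n z‖ₑ ^ 2 ∂μ) ≤ M * (A / 2) := by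
        calc M * (∫⁻ z in (Metric.ball (ζ n) r)ᶜ, ‖F n z‖ₑ ^ 2 ∂μ)
            = (M / (A / 2) * ∫⁻ z in (Metric.ball (ζ n) r)ᶜ, ‖F n z‖ₑ ^ 2 ∂μ) * (A / 2) := by
              rw [mul_right_comm, ENNReal.div_mul_cancel hA2 hA2t]
          _ ≤ _ := by gcongr
      exact (ENNReal.mul_le_mul_iff_right hM0 hM).1 h3
  have h5 := hFA n
  rw [← lintegral_add_compl _ (measurableSet_ball (x := ζ n) (ε := r))] at h5
  have h6 : A / 2 + A / 2 ≤ (∫⁻ z in Metric.ball (ζ n) r, ‖F n z‖ₑ ^ 2 ∂μ) + A / 2 := by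
    rw [ENNReal.add_halves]
    exact h5.trans (by gcongr)
  exact (ENNReal.add_le_add_iff_right hA2t).1 h6

variable [NormedSpace ℝ E] [FiniteDimensional ℝ E] [μ.IsAddHaarMeasure]

theorem lintegral_polyWeight_neg_lt_top {p : ℝ} (hp : (Module.finrank ℝ E : ℝ) < p) :
    ∫⁻ y, polyWeight (-p) y ∂μ < ∞ := by
  have h := (integrable_one_add_norm (μ := μ) hp).lintegral_lt_top
  refine lt_of_le_of_lt (lintegral_mono fun y => le_of_eq ?_) h
  have h0 : (0 : ℝ) < 1 + ‖y‖ := by positivity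
  rw [polyWeight, ← ENNReal.ofReal_rpow_of_pos h0, ENNReal.ofReal_add (by norm_num)
    (norm_nonneg _), ENNReal.ofReal_one, ofReal_norm]

theorem tendsto_tail_lintegral_polyWeight_neg {p : ℝ} (hp : (Module.finrank ℝ E : ℝ) < p) :
    Filter.Tendsto (fun ρ : ℝ => ∫⁻ y, {y : E | ρ ≤ ‖y‖}.indicator (polyWeight (-p)) y ∂μ)
      Filter.atTop (nhds 0) := by
  have hlim : ∫⁻ _ : E, (0 : ℝ≥0∞) ∂μ = 0 := by simp
  rw [← hlim]
  refine tendsto_lintegral_filter_of_dominated_convergence (polyWeight (-p)) ?_ ?_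
    (lintegral_polyWeight_neg_lt_top μ hp).ne ?_
  · exact Filter.Eventually.of_forall fun ρ => (measurable_polyWeight _).indicator
      (measurableSet_le measurable_const measurable_norm)
  · exact Filter.Eventually.of_forall fun ρ => Filter.Eventually.of_forall fun y =>
      Set.indicator_le_self _ _ _
  · refine Filter.Eventually.of_forall fun y => ?_
    refine tendsto_const_nhds.congr' ?_
    filter_upwards [Filter.eventually_gt_atTop ‖y‖] with ρ hρ
    rw [Set.indicator_of_notMem]
    simpa using hρ

/-- This replaces separation of the centres. Each weight is spread over the ball around `ζ n`,
against the mass `A` that `|F n|²` has there; then the pointwise bound `B` is applied under the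
integral, leaving one tail integral independent of `J` and `z`. -/
theorem sum_tail_polyWeight_le (hs : 0 < s) (hFm : ∀ n, Measurable (F n))
    (hFB : ∀ (J : Finset ι) (z : E), ∑ n ∈ J, ‖F n z‖ₑ ^ 2 ≤ B) {r : ℝ}
    (hr : ∀ n, A ≤ ∫⁻ z in Metric.ball (ζ n) r, ‖F n z‖ₑ ^ 2 ∂μ) (R : ℝ) (J : Finset ι) (z : E) :
    (∑ n ∈ J, (Metric.ball (ζ n) R)ᶜ.indicator (fun _ => polyWeight (-(2 * s)) (z - ζ n)) z) * A
      ≤ ENNReal.ofReal (1 + r) ^ (2 * s) * B *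
        ∫⁻ y, {y : E | R - r ≤ ‖y‖}.indicator (polyWeight (-(2 * s))) y ∂μ := by
  have hp : 0 ≤ 2 * s := by positivity
  set κ := {y : E | R - r ≤ ‖y‖}.indicator (polyWeight (-(2 * s)))
  have hκ : Measurable κ := (measurable_polyWeight _).indicator
      (measurableSet_le measurable_const measurable_norm)
  have hκz : Measurable fun w => κ (z - w) := hκ.comp (measurable_id.const_sub z)
  have hterm : ∀ n, (Metric.ball (ζ n) R)ᶜ.indicator
      (fun _ => polyWeight (-(2 * s)) (z - ζ n)) z * A
      ≤ ∫⁻ w, ENNReal.ofReal (1 + r) ^ (2 * s) * κ (z - w) * ‖F n w‖ₑ ^ 2 ∂μ := by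
    intro n
    by_cases hz : z ∈ (Metric.ball (ζ n) R)ᶜ
    · rw [Set.indicator_of_mem hz]
      calc polyWeight (-(2 * s)) (z - ζ n) * A
          ≤ polyWeight (-(2 * s)) (z - ζ n) * ∫⁻ w in Metric.ball (ζ n) r, ‖F n w‖ₑ ^ 2 ∂μ := by
            gcongr; exact hr n
        _ = ∫⁻ w in Metric.ball (ζ n) r, polyWeight (-(2 * s)) (z - ζ n) * ‖F n w‖ₑ ^ 2 ∂μ := by
            rw [lintegral_const_mul _ ((hFm n).enorm.pow_const 2)]
        _ ≤ ∫⁻ w in Metric.ball (ζ n) r,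
              ENNReal.ofReal (1 + r) ^ (2 * s) * κ (z - w) * ‖F n w‖ₑ ^ 2 ∂μ := by
            refine setLIntegral_mono' measurableSet_ball fun w hw => ?_
            gcongr
            rw [Metric.mem_ball, dist_eq_norm] at hw
            have hz' : R ≤ ‖z - ζ n‖ := by simpa [Metric.mem_ball, dist_eq_norm] using hz
            have hmem : z - w ∈ {y : E | R - r ≤ ‖y‖} := by
              have h3 : ‖z - ζ n‖ ≤ ‖z - w‖ + ‖w - ζ n‖ := by
                simpa using norm_add_le (z - w) (w - ζ n)
              simp only [Set.mem_ofPred_eq]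
              linarith
            have hk : κ (z - w) = polyWeight (-(2 * s)) (z - w) := Set.indicator_of_mem hmem _
            rw [hk]
            exact polyWeight_neg_le hp hw.le
        _ ≤ _ := setLIntegral_le_lintegral _ _
    · rw [Set.indicator_of_notMem hz, zero_mul]
      exact zero_le
  rw [Finset.sum_mul]
  refine (Finset.sum_le_sum fun n _ => hterm n).trans ?_
  have hm : ∀ n, Measurable fun w =>
      ENNReal.ofReal (1 + r) ^ (2 * s) * κ (z - w) * ‖F n w‖ₑ ^ 2 := fun n =>
    (hκz.const_mul _).mul ((hFm n).enorm.pow_const 2)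
  rw [← lintegral_finsetSum _ fun n _ => hm n]
  calc ∫⁻ w, ∑ n ∈ J, ENNReal.ofReal (1 + r) ^ (2 * s) * κ (z - w) * ‖F n w‖ₑ ^ 2 ∂μ
      ≤ ∫⁻ w, ENNReal.ofReal (1 + r) ^ (2 * s) * B * κ (z - w) ∂μ := by
        refine lintegral_mono fun w => ?_
        rw [← Finset.mul_sum, mul_right_comm _ B]
        gcongr
        exact hFB J w
    _ = _ := by
        rw [lintegral_const_mul _ hκz, lintegral_sub_left_eq_self κ z]

theorem ennreal_sum_mul_sq_le (J : Finset ι) (u v : ι → ℝ≥0∞) :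
    (∑ n ∈ J, u n * v n) ^ 2 ≤ (∑ n ∈ J, u n ^ 2) * ∑ n ∈ J, v n ^ 2 := by
  have h := ENNReal.inner_le_Lp_mul_Lq J u v (p := 2) (q := 2)
    (by rw [Real.holderConjugate_iff]; norm_num)
  have h2 := pow_le_pow_left₀ zero_le h 2
  refine h2.trans (le_of_eq ?_)
  rw [mul_pow, ← ENNReal.rpow_natCast, ← ENNReal.rpow_natCast, ← ENNReal.rpow_mul,
    ← ENNReal.rpow_mul]
  simp

/-- Sequences of functions that are uniformly concentrated, in the sense of a moment of order
exceeding the dimension, form a family whose tails are almost orthogonal. -/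
theorem exists_radius_tail_synthesis_le (hs : (Module.finrank ℝ E : ℝ) < 2 * s) (hs0 : 0 < s)
    (hFm : ∀ n, Measurable (F n))
    (hM : M ≠ ∞) (hB : B ≠ ∞) (hA0 : A ≠ 0) (hAtop : A ≠ ∞)
    (hFM : ∀ n, ∫⁻ z, polyWeight (2 * s) (z - ζ n) * ‖F n z‖ₑ ^ 2 ∂μ ≤ M)
    (hFA : ∀ n, A ≤ ∫⁻ z, ‖F n z‖ₑ ^ 2 ∂μ)
    (hFB : ∀ (J : Finset ι) (z : E), ∑ n ∈ J, ‖F n z‖ₑ ^ 2 ≤ B)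
    {ε : ℝ≥0∞} (hε : ε ≠ 0) :
    ∃ R₀ : ℝ, 0 < R₀ ∧ ∀ R : ℝ, R₀ ≤ R → ∀ (J : Finset ι) (c : ι → ℂ),
      ∫⁻ z, (∑ n ∈ J, ‖c n‖ₑ * (Metric.ball (ζ n) R)ᶜ.indicator (fun z => ‖F n z‖ₑ) z) ^ 2 ∂μ
        ≤ ε * ∑ n ∈ J, ‖c n‖ₑ ^ 2 := by
  obtain ⟨r, hr0, hr⟩ := exists_radius_concentration μ hs0 hFm hM hA0 hAtop hFM hFA
  have hA2 : A / 2 ≠ 0 := by simp [hA0]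
  have hA2t : A / 2 ≠ ∞ := by simp [ENNReal.div_eq_top, hAtop]
  set K : ℝ≥0∞ := ENNReal.ofReal (1 + r) ^ (2 * s) * B with hK
  have hKtop : K ≠ ∞ := ENNReal.mul_ne_top
    (ENNReal.rpow_ne_top_of_nonneg (by positivity) ENNReal.ofReal_ne_top) hB
  set T : ℝ → ℝ≥0∞ :=
    fun ρ => ∫⁻ y, {y : E | ρ ≤ ‖y‖}.indicator (polyWeight (-(2 * s))) y ∂μ with hT
  have hlim : Filter.Tendsto (fun R : ℝ => K * T (R - r) / (A / 2) * M) Filter.atTop (nhds 0) := by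
    have h1 : Filter.Tendsto (fun R : ℝ => T (R - r)) Filter.atTop (nhds 0) :=
      (tendsto_tail_lintegral_polyWeight_neg μ hs).comp
        (Filter.tendsto_atTop_add_const_right _ (-r) Filter.tendsto_id)
    have h2 := ENNReal.Tendsto.const_mul h1 (Or.inr hKtop)
    have h3 := ENNReal.Tendsto.div_const h2 (Or.inr hA2)
    have h4 := ENNReal.Tendsto.mul_const h3 (Or.inr hM)
    simpa using h4
  obtain ⟨R₁, hR₁⟩ := Filter.eventually_atTop.1 (hlim.eventually_le_const (pos_iff_ne_zero.2 hε))
  refine ⟨max R₁ 1, by positivity, fun R hR J c => ?_⟩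
  have hRε := hR₁ R ((le_max_left _ _).trans hR)
  -- Cauchy-Schwarz after inserting `1 = (1+|z-ζ n|)^{-s} (1+|z-ζ n|)^s`. The first factor is
  -- uniformly small by the tail estimate; the second integrates to at most `M ∑ |c n|²`.
  have hpt : ∀ z, (∑ n ∈ J, ‖c n‖ₑ *
        (Metric.ball (ζ n) R)ᶜ.indicator (fun z => ‖F n z‖ₑ) z) ^ 2
      ≤ K * T (R - r) / (A / 2) *
        ∑ n ∈ J, ‖c n‖ₑ ^ 2 * (polyWeight (2 * s) (z - ζ n) * ‖F n z‖ₑ ^ 2) := by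
    intro z
    have h1 := sum_tail_polyWeight_le μ hs0 hFm hFB hr R J z
    rw [← ENNReal.le_div_iff_mul_le (Or.inl hA2) (Or.inl hA2t)] at h1
    calc (∑ n ∈ J, ‖c n‖ₑ * (Metric.ball (ζ n) R)ᶜ.indicator (fun z => ‖F n z‖ₑ) z) ^ 2
        = (∑ n ∈ J, (Metric.ball (ζ n) R)ᶜ.indicator (fun _ => polyWeight (-s) (z - ζ n)) z
            * (‖c n‖ₑ * (polyWeight s (z - ζ n) * ‖F n z‖ₑ))) ^ 2 := by
          congr 1
          refine Finset.sum_congr rfl fun n _ => ?_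
          by_cases hz : z ∈ (Metric.ball (ζ n) R)ᶜ
          · rw [Set.indicator_of_mem hz, Set.indicator_of_mem hz]
            calc ‖c n‖ₑ * ‖F n z‖ₑ
                = (polyWeight (-s) (z - ζ n) * polyWeight s (z - ζ n)) * (‖c n‖ₑ * ‖F n z‖ₑ) := by
                  rw [← polyWeight_add, neg_add_cancel, polyWeight_zero, one_mul]
              _ = _ := by ring
          · rw [Set.indicator_of_notMem hz, Set.indicator_of_notMem hz, mul_zero, zero_mul]
      _ ≤ _ := ennreal_sum_mul_sq_le J _ _
      _ = (∑ n ∈ J, (Metric.ball (ζ n) R)ᶜ.indicator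
              (fun _ => polyWeight (-(2 * s)) (z - ζ n)) z) *
            ∑ n ∈ J, ‖c n‖ₑ ^ 2 * (polyWeight (2 * s) (z - ζ n) * ‖F n z‖ₑ ^ 2) := by
          congr 1
          · refine Finset.sum_congr rfl fun n _ => ?_
            by_cases hz : z ∈ (Metric.ball (ζ n) R)ᶜ
            · rw [Set.indicator_of_mem hz, Set.indicator_of_mem hz, polyWeight_sq, mul_neg]
            · rw [Set.indicator_of_notMem hz, Set.indicator_of_notMem hz]
              simp
          · refine Finset.sum_congr rfl fun n _ => ?_
            rw [mul_pow, mul_pow, polyWeight_sq]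
      _ ≤ _ := by gcongr
  have hmn : ∀ n, Measurable fun z => polyWeight (2 * s) (z - ζ n) * ‖F n z‖ₑ ^ 2 := fun n =>
    ((measurable_polyWeight _).comp (measurable_id.sub_const _)).mul ((hFm n).enorm.pow_const 2)
  calc _ ≤ ∫⁻ z, K * T (R - r) / (A / 2) *
          ∑ n ∈ J, ‖c n‖ₑ ^ 2 * (polyWeight (2 * s) (z - ζ n) * ‖F n z‖ₑ ^ 2) ∂μ :=
        lintegral_mono hpt
    _ = K * T (R - r) / (A / 2) *
          ∑ n ∈ J, ‖c n‖ₑ ^ 2 * ∫⁻ z, polyWeight (2 * s) (z - ζ n) * ‖F n z‖ₑ ^ 2 ∂μ := by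
        rw [lintegral_const_mul _ (Finset.measurable_sum _ fun n _ => (hmn n).const_mul _),
          lintegral_finsetSum _ fun n _ => (hmn n).const_mul _]
        congr 1
        exact Finset.sum_congr rfl fun n _ => lintegral_const_mul _ (hmn n)
    _ ≤ K * T (R - r) / (A / 2) * ∑ n ∈ J, ‖c n‖ₑ ^ 2 * M := by
        gcongr with n
        exact hFM n
    _ = (K * T (R - r) / (A / 2) * M) * ∑ n ∈ J, ‖c n‖ₑ ^ 2 := by
        rw [← Finset.sum_mul]; ring
    _ ≤ _ := by gcongr

end PolyWeight

/-! ### Bessel's inequality and perturbation of Riesz bases. -/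

section RieszBasis

variable {H : Type*} [NormedAddCommGroup H] [InnerProductSpace ℂ H]

/-- The analysis operator is the adjoint of synthesis, hence has the same bound. The test
coefficients are `⟨f n, h⟩` themselves. -/
theorem sum_norm_inner_sq_le {f : ℕ → H} {B : ℝ} (hB0 : 0 ≤ B) {J : Finset ℕ}
    (hB : ∀ c : ℕ → ℂ, ‖∑ n ∈ J, c n • f n‖ ^ 2 ≤ B * ∑ n ∈ J, ‖c n‖ ^ 2) (h : H) :
    ∑ n ∈ J, ‖inner ℂ (f n) h‖ ^ 2 ≤ B * ‖h‖ ^ 2 := by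
  set S : ℝ := ∑ n ∈ J, ‖inner ℂ (f n) h‖ ^ 2 with hS
  have hS0 : 0 ≤ S := by positivity
  set v : H := ∑ n ∈ J, inner ℂ (f n) h • f n with hv
  have h1 : inner ℂ v h = (S : ℂ) := by
    rw [hv, sum_inner, hS]
    push_cast
    refine Finset.sum_congr rfl fun n _ => ?_
    rw [inner_smul_left, RCLike.conj_mul]
    rfl
  have h2 : S ≤ ‖v‖ * ‖h‖ := by
    have h3 := norm_inner_le_norm (𝕜 := ℂ) v h
    rwa [h1, Complex.norm_real, Real.norm_of_nonneg hS0] at h3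
  have h4 : ‖v‖ ^ 2 ≤ B * S := hB _
  rcases hS0.eq_or_lt with h0 | h0
  · rw [← h0]
    positivity
  · have h5 : S ^ 2 ≤ B * S * ‖h‖ ^ 2 := by
      calc S ^ 2 ≤ (‖v‖ * ‖h‖) ^ 2 := by gcongr
        _ = ‖v‖ ^ 2 * ‖h‖ ^ 2 := by ring
        _ ≤ _ := by gcongr
    have h6 : S * S ≤ S * (B * ‖h‖ ^ 2) := by linarith
    exact le_of_mul_le_mul_left h6 h0

/-- A sequence whose synthesis operator is close to that of a Riesz basis is a Riesz basis. -/
theorem IsRieszBasis.of_perturbation {f h : ℕ → H} {A B : ℝ} (hA : 0 < A) (hB : 0 < B)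
    (hd : (Submodule.span ℂ (Set.range f)).topologicalClosure = ⊤) [CompleteSpace H]
    (hAB : ∀ (J : Finset ℕ) (c : ℕ → ℂ),
      A * ∑ n ∈ J, ‖c n‖ ^ 2 ≤ ‖∑ n ∈ J, c n • f n‖ ^ 2 ∧
      ‖∑ n ∈ J, c n • f n‖ ^ 2 ≤ B * ∑ n ∈ J, ‖c n‖ ^ 2)
    (hfh : ∀ (J : Finset ℕ) (c : ℕ → ℂ),
      ‖∑ n ∈ J, c n • (f n - h n)‖ ^ 2 ≤ A / 4 * ∑ n ∈ J, ‖c n‖ ^ 2) :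
    IsRieszBasis h := by
  have hsplit : ∀ (J : Finset ℕ) (c : ℕ → ℂ), ∑ n ∈ J, c n • (f n - h n)
      = ∑ n ∈ J, c n • f n - ∑ n ∈ J, c n • h n := by
    intro J c
    simp only [smul_sub, Finset.sum_sub_distrib]
  -- The constant `A/4` and the lower Riesz bound make the perturbation at most half of `∑ c n • f
  -- n`. The new bounds are therefore `(1/2)² A` and `(3/2)² B`.
  have hhalf : ∀ (J : Finset ℕ) (c : ℕ → ℂ),
      ‖∑ n ∈ J, c n • f n - ∑ n ∈ J, c n • h n‖ ≤ ‖∑ n ∈ J, c n • f n‖ / 2 := by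
    intro J c
    rw [← hsplit]
    refine le_of_sq_le_sq ?_ (by positivity)
    rw [div_pow]
    linarith [hfh J c, (hAB J c).1]
  refine ⟨?_, A / 4, 9 / 4 * B, by positivity, by positivity, fun J c => ⟨?_, ?_⟩⟩
  · rw [Submodule.topologicalClosure_eq_top_iff, Submodule.eq_bot_iff]
    intro v hv
    -- For `v` orthogonal to every `h n`, subtracting `∑ c n • h n` does not change the inner
    -- product of `v` with `∑ c n • f n`. The resulting bound extends from the dense span to `u = v`
    -- and forces `v = 0`.
    have hle : ∀ u : H, ‖inner ℂ v u‖ ≤ ‖v‖ * (‖u‖ / 2) := by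
      have hcl : IsClosed {u : H | ‖inner ℂ v u‖ ≤ ‖v‖ * (‖u‖ / 2)} :=
        isClosed_le (continuous_const.inner continuous_id).norm (by fun_prop)
      have hsub : (Submodule.span ℂ (Set.range f) : Set H)
          ⊆ {u : H | ‖inner ℂ v u‖ ≤ ‖v‖ * (‖u‖ / 2)} := by
        intro u hu
        obtain ⟨c, rfl⟩ := Finsupp.mem_span_range_iff_exists_finsupp.1 hu
        have hw : ∑ n ∈ c.support, c n • h n ∈ Submodule.span ℂ (Set.range h) :=
          Submodule.sum_mem _ fun n _ => Submodule.smul_mem _ _ (Submodule.subset_span ⟨n, rfl⟩)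
        have h0 : inner ℂ v (∑ n ∈ c.support, c n • h n) = 0 :=
          (Submodule.mem_orthogonal' _ v).1 hv _ hw
        have h1 := hhalf c.support c
        rw [Set.mem_ofPred_eq, Finsupp.sum]
        calc ‖inner ℂ v (∑ n ∈ c.support, c n • f n)‖
            = ‖inner ℂ v (∑ n ∈ c.support, c n • f n - ∑ n ∈ c.support, c n • h n)‖ := by
              rw [inner_sub_right, h0, sub_zero]
          _ ≤ ‖v‖ * ‖∑ n ∈ c.support, c n • f n - ∑ n ∈ c.support, c n • h n‖ :=
              norm_inner_le_norm _ _
          _ ≤ _ := by gcongr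
      intro u
      have h1 := closure_minimal hsub hcl
      rw [← Submodule.topologicalClosure_coe, hd] at h1
      exact h1 (Set.mem_univ u)
    have h1 := hle v
    rw [inner_self_eq_norm_sq_to_K, norm_pow, RCLike.norm_ofReal, abs_norm] at h1
    have h2 : ‖v‖ ^ 2 ≤ 0 := by nlinarith [norm_nonneg v]
    exact norm_eq_zero.1 (pow_eq_zero_iff (two_ne_zero) |>.1 (le_antisymm h2 (sq_nonneg _)))
  · have h1 := hhalf J c
    have h2 : ‖∑ n ∈ J, c n • f n‖ ≤ ‖∑ n ∈ J, c n • f n - ∑ n ∈ J, c n • h n‖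
        + ‖∑ n ∈ J, c n • h n‖ := norm_le_norm_sub_add _ _
    have h3 : ‖∑ n ∈ J, c n • f n‖ / 2 ≤ ‖∑ n ∈ J, c n • h n‖ := by linarith
    have h4 : (‖∑ n ∈ J, c n • f n‖ / 2) ^ 2 ≤ ‖∑ n ∈ J, c n • h n‖ ^ 2 := by gcongr
    linarith [(hAB J c).1]
  · have h1 := hhalf J c
    have h2 : ‖∑ n ∈ J, c n • h n‖ ≤ ‖∑ n ∈ J, c n • h n - ∑ n ∈ J, c n • f n‖
        + ‖∑ n ∈ J, c n • f n‖ := norm_le_norm_sub_add _ _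
    rw [norm_sub_rev] at h2
    have h3 : ‖∑ n ∈ J, c n • h n‖ ≤ 3 / 2 * ‖∑ n ∈ J, c n • f n‖ := by linarith
    have h4 : ‖∑ n ∈ J, c n • h n‖ ^ 2 ≤ (3 / 2 * ‖∑ n ∈ J, c n • f n‖) ^ 2 := by gcongr
    linarith [(hAB J c).2]

end RieszBasis

/-! ### The localization operator as a cutoff in phase space. -/

instance isAddHaarMeasure_volume_euc_prod (d : ℕ) :
    (volume : Measure (Euc d × Euc d)).IsAddHaarMeasure := by
  rw [Measure.volume_eq_prod]
  infer_instance

/-- The product carries the maximum norm, in which a product of two balls of equal radius is a ball.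
-/
theorem locOp_eq_setIntegral_ball {d : ℕ} (R : ℝ) (f : L2 d) :
    locOp R f = ∫ z in Metric.ball (0 : Euc d × Euc d) R,
      stft f z.1 z.2 • tfShift z.1 z.2 (gauss d) := by
  rw [locOp, ball_prod_same]
  rfl

theorem integrableOn_stft_smul_tfShift {d : ℕ} (R : ℝ) (f : L2 d) :
    IntegrableOn (fun z : Euc d × Euc d => stft f z.1 z.2 • tfShift z.1 z.2 (gauss d))
      (Metric.ball 0 R) :=
  (((continuous_stft f).smul (continuous_tfShift_gauss d)).continuousOn.integrableOn_compact
    (isCompact_closedBall 0 R)).mono_set Metric.ball_subset_closedBall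

theorem inner_sub_locOp {d : ℕ} (R : ℝ) (h f : L2 d) :
    inner ℂ h (f - locOp R f) = ∫ z in (Metric.ball (0 : Euc d × Euc d) R)ᶜ,
      inner ℂ (stft h z.1 z.2) (stft f z.1 z.2) := by
  have h1 : inner ℂ h (locOp R f) = ∫ z in Metric.ball (0 : Euc d × Euc d) R,
      inner ℂ (stft h z.1 z.2) (stft f z.1 z.2) := by
    rw [locOp_eq_setIntegral_ball, ← integral_inner (integrableOn_stft_smul_tfShift R f)]
    refine integral_congr_ae (Filter.Eventually.of_forall fun z => ?_)
    simp only [inner_smul_right, RCLike.inner_apply]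
    rw [stft, stft, inner_conj_symm]
  rw [inner_sub_right, h1, ← integral_inner_stft h f,
    ← integral_add_compl (measurableSet_ball (x := (0 : Euc d × Euc d)) (ε := R))
      (integrable_inner_stft h f), add_sub_cancel_left]

/-- Conjugation by `π(a, b)` translates the cutoff to `(a, b)`; the phases of the two transforms
cancel in the inner product. -/
theorem inner_sub_tfShift_locOp {d : ℕ} (R : ℝ) (a b : Euc d) (h f : L2 d) :
    inner ℂ h (f - tfShift a b (locOp R (tfUnshift a b f)))
      = ∫ z in (Metric.ball ((a, b) : Euc d × Euc d) R)ᶜ,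
          inner ℂ (stft h z.1 z.2) (stft f z.1 z.2) := by
  have h1 : f - tfShift a b (locOp R (tfUnshift a b f))
      = tfShift a b (tfUnshift a b f - locOp R (tfUnshift a b f)) := by
    rw [← tfShiftₗᵢ_apply a b (tfUnshift a b f - _), map_sub, tfShiftₗᵢ_apply, tfShiftₗᵢ_apply,
      tfShift_tfUnshift]
  rw [h1]
  conv_lhs => rw [← tfShift_tfUnshift a b h]
  rw [inner_tfShift_tfShift, inner_sub_locOp]
  rw [← integral_indicator measurableSet_ball.compl, ← integral_indicator measurableSet_ball.compl,
    ← integral_add_right_eq_self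
      ((Metric.ball ((a, b) : Euc d × Euc d) R)ᶜ.indicator
        fun z => inner ℂ (stft h z.1 z.2) (stft f z.1 z.2)) (a, b)]
  refine integral_congr_ae (Filter.Eventually.of_forall fun z => ?_)
  have hiff : z + (a, b) ∈ (Metric.ball ((a, b) : Euc d × Euc d) R)ᶜ
      ↔ z ∈ (Metric.ball (0 : Euc d × Euc d) R)ᶜ := by
    simp [Metric.mem_ball, dist_eq_norm]
  by_cases hz : z ∈ (Metric.ball (0 : Euc d × Euc d) R)ᶜ
  · beta_reduce
    rw [Set.indicator_of_mem hz, Set.indicator_of_mem (hiff.2 hz), stft_tfUnshift, stft_tfUnshift]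
    simp only [RCLike.inner_apply, map_mul, conj_character, Prod.fst_add, Prod.snd_add]
    linear_combination (stft f (z.1 + a) (z.2 + b) *
      (starRingEnd ℂ) (stft h (z.1 + a) (z.2 + b))) * character_neg_mul z.2 a
  · beta_reduce
    rw [Set.indicator_of_notMem hz, Set.indicator_of_notMem (fun h => hz (hiff.1 h))]

theorem ennreal_two_mul_mul_le (a b : ℝ≥0∞) : 2 * (a * b) ≤ a ^ 2 + b ^ 2 := by
  wlog h : a ≤ b generalizing a b
  · rw [mul_comm a b, add_comm]
    exact this b a (le_of_not_ge h)
  obtain ⟨c, rfl⟩ := exists_add_of_le h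
  calc 2 * (a * (a + c)) = a ^ 2 + (a ^ 2 + 2 * a * c) := by ring
    _ ≤ a ^ 2 + (a ^ 2 + 2 * a * c + c ^ 2) := by gcongr a ^ 2 + ?_; exact le_self_add
    _ = _ := by ring

/-- The adjoint of the isometry `V` is a contraction. Concretely, the sum `v` is paired with itself,
giving `‖v‖² ≤ ∫ |V v| G`. -/
theorem enorm_sum_sub_tfShift_locOp_sq_le {d : ℕ} (a b : ℕ → Euc d) (f : ℕ → L2 d) (R : ℝ)
    (J : Finset ℕ) (c : ℕ → ℂ) :
    ‖∑ n ∈ J, c n • (f n - tfShift (a n) (b n) (locOp R (tfUnshift (a n) (b n) (f n))))‖ₑ ^ 2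
      ≤ ∫⁻ z : Euc d × Euc d, (∑ n ∈ J, ‖c n‖ₑ *
        (Metric.ball ((a n, b n) : Euc d × Euc d) R)ᶜ.indicator
          (fun z => ‖stft (f n) z.1 z.2‖ₑ) z) ^ 2 := by
  set v := ∑ n ∈ J, c n • (f n - tfShift (a n) (b n) (locOp R (tfUnshift (a n) (b n) (f n))))
    with hv
  set G : Euc d × Euc d → ℝ≥0∞ := fun z => ∑ n ∈ J, ‖c n‖ₑ *
        (Metric.ball ((a n, b n) : Euc d × Euc d) R)ᶜ.indicator
          (fun z => ‖stft (f n) z.1 z.2‖ₑ) z with hG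
  have hVm : ∀ u : L2 d, Measurable fun z : Euc d × Euc d => ‖stft u z.1 z.2‖ₑ :=
    fun u => (continuous_stft u).measurable.enorm
  have hm : ∀ n, Measurable fun z : Euc d × Euc d => ‖c n‖ₑ *
        (Metric.ball ((a n, b n) : Euc d × Euc d) R)ᶜ.indicator
          (fun z => ‖stft (f n) z.1 z.2‖ₑ) z := fun n =>
    ((hVm (f n)).indicator measurableSet_ball.compl).const_mul _
  have h1 : ‖v‖ₑ ^ 2 ≤ ∫⁻ z : Euc d × Euc d, ‖stft v z.1 z.2‖ₑ * G z := by
    have e1 : ‖v‖ₑ ^ 2 = ‖inner ℂ v v‖ₑ := by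
      rw [inner_self_eq_norm_sq_to_K, enorm_pow]
      congr 1
      rw [← ofReal_norm, ← ofReal_norm, RCLike.norm_ofReal, abs_norm]
    have e2 : inner ℂ v v = ∑ n ∈ J, c n *
        ∫ z in (Metric.ball ((a n, b n) : Euc d × Euc d) R)ᶜ,
          inner ℂ (stft v z.1 z.2) (stft (f n) z.1 z.2) := by
      conv_lhs => rw [hv, inner_sum]
      refine Finset.sum_congr rfl fun n _ => ?_
      rw [inner_smul_right, ← hv, inner_sub_tfShift_locOp]
    rw [e1, e2]
    calc _ ≤ ∑ n ∈ J, ‖c n * ∫ z in (Metric.ball ((a n, b n) : Euc d × Euc d) R)ᶜ,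
          inner ℂ (stft v z.1 z.2) (stft (f n) z.1 z.2)‖ₑ := enorm_sum_le _ _
      _ ≤ ∑ n ∈ J, ∫⁻ z : Euc d × Euc d, ‖stft v z.1 z.2‖ₑ * (‖c n‖ₑ *
            (Metric.ball ((a n, b n) : Euc d × Euc d) R)ᶜ.indicator
              (fun z => ‖stft (f n) z.1 z.2‖ₑ) z) := by
          refine Finset.sum_le_sum fun n _ => ?_
          rw [enorm_mul]
          refine (mul_le_mul_right (enorm_integral_le_lintegral_enorm _) _).trans ?_
          rw [← lintegral_indicator measurableSet_ball.compl, ← lintegral_const_mul']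
          · refine lintegral_mono fun z => ?_
            by_cases hz : z ∈ (Metric.ball ((a n, b n) : Euc d × Euc d) R)ᶜ
            · rw [Set.indicator_of_mem hz, Set.indicator_of_mem hz, RCLike.inner_apply,
                enorm_mul, ← ofReal_norm ((starRingEnd ℂ) _), RCLike.norm_conj, ofReal_norm]
              exact le_of_eq (by ring)
            · rw [Set.indicator_of_notMem hz, mul_zero]
              exact zero_le
          · exact enorm_ne_top
      _ = _ := by
          have hvm : ∀ n, Measurable fun z : Euc d × Euc d => ‖stft v z.1 z.2‖ₑ * (‖c n‖ₑ *
              (Metric.ball ((a n, b n) : Euc d × Euc d) R)ᶜ.indicator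
                (fun z => ‖stft (f n) z.1 z.2‖ₑ) z) := fun n => (hVm v).mul (hm n)
          rw [← lintegral_finsetSum _ fun n _ => hvm n]
          simp only [hG, Finset.mul_sum]
  have hGm : Measurable fun z => G z ^ 2 := (Finset.measurable_sum _ fun n _ => hm n).pow_const 2
  -- By `2xy ≤ x² + y²` and Moyal's identity, one copy of `‖v‖²` is absorbed.
  have h2 : ‖v‖ₑ ^ 2 + ‖v‖ₑ ^ 2 ≤ ‖v‖ₑ ^ 2 + ∫⁻ z, G z ^ 2 := by
    calc ‖v‖ₑ ^ 2 + ‖v‖ₑ ^ 2 = 2 * ‖v‖ₑ ^ 2 := (two_mul _).symm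
      _ ≤ 2 * ∫⁻ z : Euc d × Euc d, ‖stft v z.1 z.2‖ₑ * G z := by gcongr
      _ = ∫⁻ z : Euc d × Euc d, 2 * (‖stft v z.1 z.2‖ₑ * G z) :=
          (lintegral_const_mul' _ _ (by simp)).symm
      _ ≤ ∫⁻ z : Euc d × Euc d, (‖stft v z.1 z.2‖ₑ ^ 2 + G z ^ 2) :=
          lintegral_mono fun z => ennreal_two_mul_mul_le _ _
      _ = _ := by
          rw [lintegral_add_right _ hGm, lintegral_enorm_stft_sq]
  exact (ENNReal.add_le_add_iff_left (by simp)).1 h2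

/-! ### Pointwise Gaussian bounds for the localized functions. -/

theorem isClosed_setOf_ae_norm_le {d : ℕ} (G : Euc d → ℝ) :
    IsClosed {f : L2 d | ∀ᵐ t, ‖f t‖ ≤ G t} := by
  refine IsSeqClosed.isClosed fun u f hu hf => ?_
  obtain ⟨ns, -, hns⟩ := (tendstoInMeasure_of_tendsto_Lp hf).exists_seq_tendsto_ae
  filter_upwards [hns, ae_all_iff.2 hu] with t h1 h2
  exact le_of_tendsto h1.norm (Filter.Eventually.of_forall fun k => h2 (ns k))

theorem convex_setOf_ae_norm_le {d : ℕ} (G : Euc d → ℝ) :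
    Convex ℝ {f : L2 d | ∀ᵐ t, ‖f t‖ ≤ G t} := by
  intro u hu v hv α β hα hβ hαβ
  filter_upwards [hu, hv, Lp.coeFn_add (α • u) (β • v), Lp.coeFn_smul α u, Lp.coeFn_smul β v]
    with t h1 h2 h3 h4 h5
  rw [h3, Pi.add_apply, h4, h5, Pi.smul_apply, Pi.smul_apply]
  calc ‖α • u t + β • v t‖ ≤ α * ‖u t‖ + β * ‖v t‖ := by
        refine (norm_add_le _ _).trans (le_of_eq ?_)
        rw [norm_smul, norm_smul, Real.norm_of_nonneg hα, Real.norm_of_nonneg hβ]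
    _ ≤ α * G t + β * G t := by gcongr
    _ = G t := by rw [← add_mul, hαβ, one_mul]

/-- Functions dominated by `G` form a closed convex set, which contains the average of the
`L²`-valued integrand. This yields a pointwise bound without choosing representatives jointly
measurable in `z` and `t`. -/
theorem ae_norm_setIntegral_le {d : ℕ} {α : Type*} [MeasurableSpace α] {μ : Measure α} {Q : Set α}
    (hQ : MeasurableSet Q) (hQ0 : μ Q ≠ 0) (hQt : μ Q ≠ ∞) {φ : α → L2 d}
    (hφ : IntegrableOn φ Q μ) {G : Euc d → ℝ} (hG : ∀ z ∈ Q, ∀ᵐ t, ‖φ z t‖ ≤ G t) :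
    ∀ᵐ t, ‖(∫ z in Q, φ z ∂μ) t‖ ≤ μ.real Q * G t := by
  have hmem := (convex_setOf_ae_norm_le G).set_average_mem
    (isClosed_setOf_ae_norm_le _) hQ0 hQt
    ((ae_restrict_iff' hQ).2 (Filter.Eventually.of_forall fun z hz => hG z hz)) hφ
  rw [setAverage_eq] at hmem
  have heq : ∫ z in Q, φ z ∂μ = μ.real Q • ((μ.real Q)⁻¹ • ∫ z in Q, φ z ∂μ) := by
    have hne : μ.real Q ≠ 0 := ENNReal.toReal_ne_zero.2 ⟨hQ0, hQt⟩
    rw [smul_inv_smul₀ hne]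
  rw [heq]
  filter_upwards [hmem, Lp.coeFn_smul (μ.real Q) ((μ.real Q)⁻¹ • ∫ z in Q, φ z ∂μ)] with t h1 h2
  rw [h2, Pi.smul_apply, norm_smul, Real.norm_of_nonneg measureReal_nonneg]
  gcongr

/-- The operator `L` is a shift for the position bound, and a shift followed by the Fourier
transform for the frequency bound. -/
theorem ae_norm_map_locOp_le {d : ℕ} {R : ℝ} (hR : 0 < R) (L : L2 d →L[ℂ] L2 d) {G : Euc d → ℝ}
    (hG : ∀ z ∈ Metric.ball (0 : Euc d × Euc d) R,
      ∀ᵐ t, ‖L (tfShift z.1 z.2 (gauss d)) t‖ ≤ G t) (u : L2 d) :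
    ∀ᵐ t, ‖L (locOp R u) t‖
      ≤ volume.real (Metric.ball (0 : Euc d × Euc d) R) * (‖u‖ * G t) := by
  rw [locOp_eq_setIntegral_ball, ← L.integral_comp_comm (integrableOn_stft_smul_tfShift R u)]
  refine ae_norm_setIntegral_le measurableSet_ball (Metric.measure_ball_pos volume _ hR).ne'
    measure_ball_lt_top.ne (L.integrable_comp (integrableOn_stft_smul_tfShift R u))
    (G := fun t => ‖u‖ * G t) fun z hz => ?_
  rw [map_smul]
  filter_upwards [hG z hz, Lp.coeFn_smul (stft u z.1 z.2) (L (tfShift z.1 z.2 (gauss d)))]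
    with t h1 h2
  rw [h2, Pi.smul_apply, norm_smul]
  have := norm_stft_le u z.1 z.2
  gcongr

theorem ae_norm_tfShift_gauss_le {d : ℕ} {R : ℝ} (a x ξ : Euc d) (hx : ‖x - a‖ ≤ R) :
    ∀ᵐ t, ‖tfShift x ξ (gauss d) t‖ ≤ gaussEnvelope d R (t - a) := by
  filter_upwards [tfShift_gauss_coeFn x ξ] with t ht
  rw [ht, norm_mul, norm_character, one_mul]
  have := norm_gaussFun_sub_le_envelope (t - a) (x - a) hx
  rwa [sub_sub_sub_cancel_right] at this

theorem ae_norm_smul_tfShift_gauss_le {d : ℕ} {R : ℝ} {c : ℂ} (hc : ‖c‖ = 1) (a x ξ : Euc d)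
    (hx : ‖x - a‖ ≤ R) :
    ∀ᵐ t, ‖(c • tfShift x ξ (gauss d) : L2 d) t‖ ≤ gaussEnvelope d R (t - a) := by
  filter_upwards [ae_norm_tfShift_gauss_le a x ξ hx, Lp.coeFn_smul c (tfShift x ξ (gauss d))]
    with t h1 h2
  rwa [h2, Pi.smul_apply, norm_smul, hc, one_mul]

theorem ae_norm_tfShift_locOp_le {d : ℕ} {R : ℝ} (hR : 0 < R) (a b : Euc d) (u : L2 d) :
    ∀ᵐ t, ‖tfShift a b (locOp R u) t‖
      ≤ volume.real (Metric.ball (0 : Euc d × Euc d) R) * (‖u‖ * gaussEnvelope d R (t - a)) := by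
  refine ae_norm_map_locOp_le hR (tfShiftₗᵢ a b).toContinuousLinearMap
    (G := fun t => gaussEnvelope d R (t - a)) (fun z hz => ?_) u
  change ∀ᵐ t, ‖tfShift a b (tfShift z.1 z.2 (gauss d)) t‖ ≤ _
  rw [tfShift_tfShift_gauss]
  refine ae_norm_smul_tfShift_gauss_le (norm_character _ _) _ _ _ ?_
  rw [add_sub_cancel_right]
  exact (norm_fst_le z).trans (mem_ball_zero_iff.1 hz).le

theorem ae_norm_fourier_tfShift_locOp_le {d : ℕ} {R : ℝ} (hR : 0 < R) (a b : Euc d) (u : L2 d) :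
    ∀ᵐ t, ‖(𝓕 (tfShift a b (locOp R u)) : L2 d) t‖
      ≤ volume.real (Metric.ball (0 : Euc d × Euc d) R) * (‖u‖ * gaussEnvelope d R (t - b)) := by
  refine ae_norm_map_locOp_le hR
    ((Lp.fourierTransformₗᵢ (Euc d) ℂ).toLinearIsometry.toContinuousLinearMap ∘L
      (tfShiftₗᵢ a b).toContinuousLinearMap)
    (G := fun t => gaussEnvelope d R (t - b)) (fun z hz => ?_) u
  change ∀ᵐ t, ‖(𝓕 (tfShift a b (tfShift z.1 z.2 (gauss d))) : L2 d) t‖ ≤ _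
  rw [tfShift_tfShift_gauss, FourierTransform.fourier_smul, fourier_tfShift_gauss, smul_smul]
  refine ae_norm_smul_tfShift_gauss_le ?_ _ _ _ ?_
  · rw [norm_mul, norm_character, norm_character, one_mul]
  · rw [add_sub_cancel_right]
    exact (norm_snd_le z).trans (mem_ball_zero_iff.1 hz).le

theorem lintegral_moment_le_of_ae_norm_le {d : ℕ} {R K : ℝ} (hK : 0 ≤ K) (p : ℝ) (a : Euc d)
    {v : L2 d} (hv : ∀ᵐ t, ‖v t‖ ≤ K * gaussEnvelope d R (t - a)) :
    ∫⁻ t, ‖t - a‖ₑ ^ p * ‖v t‖ₑ ^ 2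
      ≤ ENNReal.ofReal K ^ 2 * ∫⁻ y : Euc d, ‖y‖ₑ ^ p * ENNReal.ofReal (gaussEnvelope d R y) ^ 2 := by
  rw [← lintegral_const_mul' _ _ (by simp), ← lintegral_sub_right_eq_self
    (fun y => ENNReal.ofReal K ^ 2 * (‖y‖ₑ ^ p * ENNReal.ofReal (gaussEnvelope d R y) ^ 2)) a]
  refine lintegral_mono_ae ?_
  filter_upwards [hv] with t ht
  rw [mul_left_comm, ← mul_pow, ← ENNReal.ofReal_mul hK]
  gcongr
  rw [← ofReal_norm]
  exact ENNReal.ofReal_le_ofReal ht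

theorem isLocalizedAt_tfShift_locOp {d : ℕ} {R t B : ℝ} (hR : 0 < R) (ht : 0 < t)
    (a b : ℕ → Euc d) (u : ℕ → L2 d) (hu : ∀ n, ‖u n‖ ≤ B) :
    IsLocalizedAt t a b (fun n => tfShift (a n) (b n) (locOp R (u n))) := by
  set V := volume.real (Metric.ball (0 : Euc d × Euc d) R)
  have hV : 0 ≤ V := measureReal_nonneg
  set I := ∫⁻ y : Euc d, ‖y‖ₑ ^ (2 * t) * ENNReal.ofReal (gaussEnvelope d R y) ^ 2
  have hI : I < ∞ := lintegral_rpow_mul_gaussEnvelope_sq_lt_top d R (by positivity)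
  have hb : ∀ (n : ℕ) (e y : Euc d),
      V * (‖u n‖ * gaussEnvelope d R (y - e)) ≤ V * B * gaussEnvelope d R (y - e) := by
    intro n e y
    rw [← mul_assoc]
    have := gaussEnvelope_nonneg d R (y - e)
    gcongr
    exact hu n
  have hVB : 0 ≤ V * B := mul_nonneg hV ((norm_nonneg _).trans (hu 0))
  refine lt_of_le_of_lt (iSup_le fun n => add_le_add
    (lintegral_moment_le_of_ae_norm_le (R := R) hVB (2 * t) (a n) ?_)
    (lintegral_moment_le_of_ae_norm_le (R := R) hVB (2 * t) (b n) ?_))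
    (ENNReal.add_lt_top.2 ⟨ENNReal.mul_lt_top (by simp) hI, ENNReal.mul_lt_top (by simp) hI⟩)
  · filter_upwards [ae_norm_tfShift_locOp_le hR (a n) (b n) (u n)] with y hy
    exact hy.trans (hb n (a n) y)
  · filter_upwards [ae_norm_fourier_tfShift_locOp_le hR (a n) (b n) (u n)] with y hy
    exact hy.trans (hb n (b n) y)

/-! ### Uniform weighted bounds and the conclusion. -/

theorem exists_lintegral_polyWeight_stft_le {d : ℕ} {s : ℝ} (hs : 0 ≤ s) {a b : ℕ → Euc d}
    {f : ℕ → L2 d} (hloc : IsLocalizedAt s a b f) {B : ℝ≥0∞} (hB : B ≠ ∞)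
    (hf : ∀ n, ‖f n‖ₑ ^ 2 ≤ B) :
    ∃ M : ℝ≥0∞, M ≠ ∞ ∧ ∀ n, ∫⁻ z : Euc d × Euc d,
      polyWeight (2 * s) (z - (a n, b n)) * ‖stft (f n) z.1 z.2‖ₑ ^ 2 ≤ M := by
  obtain ⟨C, hC, hle⟩ := exists_lintegral_moment_stft_le d hs
  have hp : 0 ≤ 2 * s := by positivity
  have h2 : (2 : ℝ≥0∞) ^ (2 * s) ≠ ∞ := ENNReal.rpow_ne_top_of_nonneg hp (by simp)
  set P := ⨆ n, phaseSpaceMoment s (a n) (b n) (f n) with hP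
  have hPt : P ≠ ∞ := hloc.ne
  refine ⟨2 ^ (2 * s) * (B + C * (P + B)), ENNReal.mul_ne_top h2 (ENNReal.add_ne_top.2
    ⟨hB, ENNReal.mul_ne_top hC (ENNReal.add_ne_top.2 ⟨hPt, hB⟩)⟩), fun n => ?_⟩
  have hVm : Measurable fun z : Euc d × Euc d => ‖stft (f n) z.1 z.2‖ₑ ^ 2 :=
    (continuous_stft (f n)).measurable.enorm.pow_const 2
  calc ∫⁻ z : Euc d × Euc d, polyWeight (2 * s) (z - (a n, b n)) * ‖stft (f n) z.1 z.2‖ₑ ^ 2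
      ≤ ∫⁻ z : Euc d × Euc d, 2 ^ (2 * s) * (‖stft (f n) z.1 z.2‖ₑ ^ 2
          + ‖z - (a n, b n)‖ₑ ^ (2 * s) * ‖stft (f n) z.1 z.2‖ₑ ^ 2) := by
        refine lintegral_mono fun z => ?_
        have h := ennreal_add_rpow_le 1 ‖z - (a n, b n)‖ₑ hp
        rw [ENNReal.one_rpow] at h
        calc polyWeight (2 * s) (z - (a n, b n)) * ‖stft (f n) z.1 z.2‖ₑ ^ 2
            ≤ 2 ^ (2 * s) * (1 + ‖z - (a n, b n)‖ₑ ^ (2 * s)) * ‖stft (f n) z.1 z.2‖ₑ ^ 2 := by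
              gcongr
              exact h
          _ = _ := by ring
    _ = 2 ^ (2 * s) * (‖f n‖ₑ ^ 2 + ∫⁻ z : Euc d × Euc d,
          ‖z - (a n, b n)‖ₑ ^ (2 * s) * ‖stft (f n) z.1 z.2‖ₑ ^ 2) := by
        rw [lintegral_const_mul' _ _ h2, lintegral_add_left hVm, lintegral_enorm_stft_sq]
    _ ≤ _ := by
        gcongr
        · exact hf n
        · refine (hle (a n) (b n) (f n)).trans ?_
          gcongr
          · exact le_iSup (fun n => phaseSpaceMoment s (a n) (b n) (f n)) n
          · exact hf n

theorem mainTheorem3 (d : ℕ) (s : ℝ) (hs : (d : ℝ) < s)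
    (a b : ℕ → EuclideanSpace ℝ (Fin d)) (f : ℕ → L2 d)
    (hf : IsRieszBasis f) (hloc : IsLocalizedAt s a b f) :
    ∃ R₀ : ℝ, 0 < R₀ ∧ ∀ R : ℝ, R₀ ≤ R →
      IsRieszBasis (fun n => tfShift (a n) (b n) (locOp R (tfUnshift (a n) (b n) (f n)))) ∧
      ∀ t : ℝ, 0 < t →
        IsLocalizedAt t a b
          (fun n => tfShift (a n) (b n) (locOp R (tfUnshift (a n) (b n) (f n)))) := by
  obtain ⟨hdense, A, B, hA, hB, hAB⟩ := hf
  have hs0 : 0 < s := lt_of_le_of_lt (Nat.cast_nonneg d) hs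
  -- Phase space has dimension `2d`, so `s > d` is exactly integrability of `(1+|y|)^{-2s}` there.
  have hfin : (Module.finrank ℝ (Euc d × Euc d) : ℝ) < 2 * s := by
    rw [Module.finrank_prod, finrank_euclideanSpace_fin]
    push_cast
    linarith
  have hsq : ∀ v : L2 d, ‖v‖ₑ ^ 2 = ENNReal.ofReal (‖v‖ ^ 2) := fun v => by
    rw [ENNReal.ofReal_pow (norm_nonneg _), ofReal_norm]
  have hsingle : ∀ n, A ≤ ‖f n‖ ^ 2 ∧ ‖f n‖ ^ 2 ≤ B := fun n => by
    simpa using hAB {n} (fun _ => 1)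
  obtain ⟨M, hM, hFM⟩ := exists_lintegral_polyWeight_stft_le hs0.le hloc
    (B := ENNReal.ofReal B) ENNReal.ofReal_ne_top fun n => by
      rw [hsq]; exact ENNReal.ofReal_le_ofReal (hsingle n).2
  have hFA : ∀ n, ENNReal.ofReal A ≤ ∫⁻ z : Euc d × Euc d, ‖stft (f n) z.1 z.2‖ₑ ^ 2 := fun n => by
    rw [lintegral_enorm_stft_sq, hsq]
    exact ENNReal.ofReal_le_ofReal (hsingle n).1
  -- Bessel's inequality for the unit vector `π(z) g`.
  have hFB : ∀ (J : Finset ℕ) (z : Euc d × Euc d),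
      ∑ n ∈ J, ‖stft (f n) z.1 z.2‖ₑ ^ 2 ≤ ENNReal.ofReal B := by
    intro J z
    have h := sum_norm_inner_sq_le hB.le (fun c => (hAB J c).2) (tfShift z.1 z.2 (gauss d))
    rw [norm_tfShift, norm_gauss, one_pow, mul_one] at h
    refine le_trans (le_of_eq ?_) (ENNReal.ofReal_le_ofReal h)
    rw [ENNReal.ofReal_sum_of_nonneg fun n _ => by positivity]
    refine Finset.sum_congr rfl fun n _ => ?_
    rw [ENNReal.ofReal_pow (norm_nonneg _), norm_inner_symm, ofReal_norm, stft]
  obtain ⟨R₀, hR₀, hR⟩ := exists_radius_tail_synthesis_le volume hfin hs0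
    (fun n => (continuous_stft (f n)).measurable) hM ENNReal.ofReal_ne_top
    (by simpa using hA) ENNReal.ofReal_ne_top hFM hFA hFB
    (ε := ENNReal.ofReal (A / 4)) (by simpa using hA)
  refine ⟨R₀, hR₀, fun R hRR => ⟨?_, fun t ht => ?_⟩⟩
  · refine IsRieszBasis.of_perturbation hA hB hdense hAB fun J c => ?_
    have h := (enorm_sum_sub_tfShift_locOp_sq_le a b f R J c).trans (hR R hRR J c)
    rw [hsq] at h
    have hc : ∑ n ∈ J, ‖c n‖ₑ ^ 2 = ENNReal.ofReal (∑ n ∈ J, ‖c n‖ ^ 2) := by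
      rw [ENNReal.ofReal_sum_of_nonneg fun n _ => by positivity]
      refine Finset.sum_congr rfl fun n _ => ?_
      rw [ENNReal.ofReal_pow (norm_nonneg _), ofReal_norm]
    rw [hc, ← ENNReal.ofReal_mul (by positivity)] at h
    exact (ENNReal.ofReal_le_ofReal_iff (by positivity)).1 h
  · refine isLocalizedAt_tfShift_locOp (B := Real.sqrt B) (hR₀.trans_le hRR) ht a b _ fun n => ?_
    rw [norm_tfUnshift]
    exact Real.le_sqrt_of_sq_le (hsingle n).2
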